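/- Let $(M,J)$ be a smooth (Hausdorff, finite-dimensional) almost complex manifold and let $\nabla$ be a smooth torsion-free affine connection on $M$ with curvature $R(X,Y)Z=\nabla_X\nabla_YZ-\nabla_Y\nabla_XZ-\nabla_{[X,Y]}Z$. For a vector field $X$ on $M$ let $X^V$ and $X^H$ be its vertical and horizontal lifts to the tangent bundle $TM$: in the coordinates $(x^k,y^k)$ of $TM$ induced by coordinates $(x^k)$ of $M$, $X^V$ has components $(0,X^k)$ and $X^H$ has components $(X^k,-y^i\Gamma_{ij}^kX^j)$. Define tensor fields $J_1,J_2,J_3$ of type $(1,1)$ on $TM$ by $$J_1:\ X^H\mapsto X^V,\ X^V\mapsto -X^H;\qquad J_2:\ X^H\mapsto (JX)^V,\ X^V\mapsto (JX)^H;\qquad J_3=J_1\circ J_2 .$$ An almost complex structure $J_\alpha$ (a smooth $(1,1)$-tensor field with $J_\alpha^2=-\mathrm{id}$) is called integrable if its Nijenhuis tensor $N_\alpha(X,Y)=[X,Y]+J_\alpha[J_\alpha X,Y]+J_\alpha[X,J_\alpha Y]-[J_\alpha X,J_\alpha Y]$ vanishes identically. The triple $H=(J_1,J_2,J_3)$ is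 called hypercomplex if $J_1,J_2,J_3$ are pairwise anticommuting integrable almost complex structures with $J_3=J_1\circ J_2$. (i) $J_1$ is integrable if and only if $M$ is flat, i.e. $R=0$. Suppose in addition that $\nabla$ is the Levi-Civita connection of a skew-Hermitian (Norden) metric on $(M,J)$, that is, of a pseudo-Riemannian metric $g$ with $g(JX,JY)=-g(X,Y)$. Then: (ii) $J_2$ is integrable if and only if $M$ is flat and $J$ is parallel ($\nabla J=0$); likewise, $J_3$ is integrable if and only if $M$ is flat and $J$ is parallel; (iii) $H$ is hypercomplex if and only if $M$ is flat and $J$ is parallel. -/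

import Mathlib

open Bundle
open scoped Manifold ContDiff

noncomputable section

/-! ### Tensor fields of type (1,1) on a manifold and the Nijenhuis tensor -/

section General

variable {F : Type*} [NormedAddCommGroup F] [NormedSpace ℝ F]
  {K : Type*} [TopologicalSpace K] (I : ModelWithCorners ℝ F K)
  {N : Type*} [TopologicalSpace N] [ChartedSpace K N]

/-- A (not necessarily smooth) field of endomorphisms of the tangent spaces of `N`. -/
abbrev EndField (N : Type*) [TopologicalSpace N] [ChartedSpace K N] : Type _ :=
  ∀ x : N, TangentSpace I x →L[ℝ] TangentSpace I x

/-- A vector field (not necessarily smooth) on `N`. -/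
abbrev VecField (N : Type*) [TopologicalSpace N] [ChartedSpace K N] : Type _ :=
  ∀ x : N, TangentSpace I x

variable {I}

/-- `J` is an almost complex structure: a smooth tensor field with `J² = -id`. -/
structure IsAlmostComplex [IsManifold I ∞ N] (J : EndField I N) : Prop where
  smooth : ContMDiff I (I.prod 𝓘(ℝ, F →L[ℝ] F)) ∞
    (fun x ↦ TotalSpace.mk' (F →L[ℝ] F)
      (E := fun x : N ↦ TangentSpace I x →L[ℝ] TangentSpace I x) x (J x))
  sq : ∀ (x : N) (v : TangentSpace I x), J x (J x v) = -v

/-- The vector field `X` is `C^∞` at the point `p`. -/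
def SmoothVecAt [IsManifold I ∞ N] (X : VecField I N) (p : N) : Prop :=
  ContMDiffAt I I.tangent ∞ (fun x ↦ (⟨x, X x⟩ : TangentBundle I N)) p

/-- The value at `p` of `N(X,Y) = [X,Y] + J[JX,Y] + J[X,JY] - [JX,JY]`. -/
def nijenhuis (J : EndField I N) (X Y : VecField I N) (p : N) : TangentSpace I p :=
  VectorField.mlieBracket I X Y p
    + J p (VectorField.mlieBracket I (fun x ↦ J x (X x)) Y p)
    + J p (VectorField.mlieBracket I X (fun x ↦ J x (Y x)) p)
    - VectorField.mlieBracket I (fun x ↦ J x (X x)) (fun x ↦ J x (Y x)) p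

/-- `J` is an integrable almost complex structure: its Nijenhuis tensor vanishes, where the tensor is
evaluated on all local smooth vector fields. -/
def IsIntegrableComplex [IsManifold I ∞ N] (J : EndField I N) : Prop :=
  IsAlmostComplex J ∧ ∀ (p : N) (X Y : VecField I N), SmoothVecAt X p → SmoothVecAt Y p →
    nijenhuis J X Y p = 0

/-- Three anticommuting almost complex structures with `J₃ = J₁ ∘ J₂`. -/
structure IsAlmostHypercomplex [IsManifold I ∞ N] (J₁ J₂ J₃ : EndField I N) : Prop where
  first : IsAlmostComplex J₁
  second : IsAlmostComplex J₂
  third : IsAlmostComplex J₃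
  anti₁₂ : ∀ x, (J₁ x).comp (J₂ x) = -(J₂ x).comp (J₁ x)
  anti₂₃ : ∀ x, (J₂ x).comp (J₃ x) = -(J₃ x).comp (J₂ x)
  anti₃₁ : ∀ x, (J₃ x).comp (J₁ x) = -(J₁ x).comp (J₃ x)
  comp_eq : ∀ x, J₃ x = (J₁ x).comp (J₂ x)

/-- An almost hypercomplex structure all of whose three Nijenhuis tensors vanish. -/
def IsHypercomplex [IsManifold I ∞ N] (J₁ J₂ J₃ : EndField I N) : Prop :=
  IsAlmostHypercomplex J₁ J₂ J₃ ∧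
    IsIntegrableComplex J₁ ∧ IsIntegrableComplex J₂ ∧ IsIntegrableComplex J₃

end General

section Base

variable {E : Type*} [NormedAddCommGroup E] [NormedSpace ℝ E]
  {M : Type*} [TopologicalSpace M] [ChartedSpace E M] [IsManifold 𝓘(ℝ, E) ∞ M]

/-! ### Affine connections and metrics on the base -/

/-- `AffineConnection E M`: covariant derivatives on the tangent bundle of `M`, modelled on `E`.
In Mathlib's convention `D Y p v` is `(∇_v Y)(p)`. -/
abbrev AffineConnection (E : Type*) [NormedAddCommGroup E] [NormedSpace ℝ E]
    (M : Type*) [TopologicalSpace M] [ChartedSpace E M] [IsManifold 𝓘(ℝ, E) ∞ M] : Type _ :=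
  CovariantDerivative 𝓘(ℝ, E) E (TangentSpace 𝓘(ℝ, E) : M → Type _)

/-- The value at `p` of `R(X,Y)Z = ∇_X ∇_Y Z - ∇_Y ∇_X Z - ∇_[X,Y] Z`. -/
def curvature (D : AffineConnection E M) (X Y Z : VecField 𝓘(ℝ, E) M) (p : M) :
    TangentSpace 𝓘(ℝ, E) p :=
  D (fun x ↦ D Z x (Y x)) p (X p) - D (fun x ↦ D Z x (X x)) p (Y p)
    - D Z p (VectorField.mlieBracket 𝓘(ℝ, E) X Y p)

/-- The curvature tensor vanishes. -/
def IsFlat (D : AffineConnection E M) : Prop :=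
  ∀ (p : M) (X Y Z : VecField 𝓘(ℝ, E) M), SmoothVecAt X p → SmoothVecAt Y p → SmoothVecAt Z p →
    curvature D X Y Z p = 0

/-- `∇J = 0`, that is, `∇_v (JY) = J (∇_v Y)`. -/
def IsParallel (D : AffineConnection E M) (J : EndField 𝓘(ℝ, E) M) : Prop :=
  ∀ (p : M) (Y : VecField 𝓘(ℝ, E) M) (v : TangentSpace 𝓘(ℝ, E) p), SmoothVecAt Y p →
    D (fun x ↦ J x (Y x)) p v = J p (D Y p v)

/-- `g` is a pseudo-Riemannian metric: smooth, symmetric and nondegenerate. -/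
structure IsPseudoRiemannian
    (g : ∀ x : M, TangentSpace 𝓘(ℝ, E) x →L[ℝ] TangentSpace 𝓘(ℝ, E) x →L[ℝ] ℝ) : Prop where
  smooth : ContMDiff 𝓘(ℝ, E) (𝓘(ℝ, E).prod 𝓘(ℝ, E →L[ℝ] E →L[ℝ] ℝ)) ∞
    (fun x ↦ TotalSpace.mk' (E →L[ℝ] E →L[ℝ] ℝ)
      (E := fun x : M ↦ TangentSpace 𝓘(ℝ, E) x →L[ℝ] TangentSpace 𝓘(ℝ, E) x →L[ℝ] ℝ) x (g x))
  symm : ∀ x v w, g x v w = g x w v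
  nondegenerate : ∀ x v, (∀ w, g x v w = 0) → v = 0

/-- `g` is a skew-Hermitian (Norden) metric for `J`: `J` is an anti-isometry of `g`. -/
structure IsSkewHermitian (J : EndField 𝓘(ℝ, E) M)
    (g : ∀ x : M, TangentSpace 𝓘(ℝ, E) x →L[ℝ] TangentSpace 𝓘(ℝ, E) x →L[ℝ] ℝ) : Prop
    extends IsPseudoRiemannian g where
  anti : ∀ x v w, g x (J x v) (J x w) = -g x v w

/-- `∇` is torsion-free: `∇_X Y - ∇_Y X = [X,Y]`. -/
def IsTorsionFree (D : AffineConnection E M) : Prop :=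
  ∀ (p : M) (X Y : VecField 𝓘(ℝ, E) M), SmoothVecAt X p → SmoothVecAt Y p →
    D Y p (X p) - D X p (Y p) = VectorField.mlieBracket 𝓘(ℝ, E) X Y p

/-- `∇` is the Levi-Civita connection of `g`: it is torsion-free and
`v (g(Y,Z)) = g(∇_v Y, Z) + g(Y, ∇_v Z)`. -/
structure IsLeviCivita (D : AffineConnection E M)
    (g : ∀ x : M, TangentSpace 𝓘(ℝ, E) x →L[ℝ] TangentSpace 𝓘(ℝ, E) x →L[ℝ] ℝ) : Prop where
  torsionFree : IsTorsionFree D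
  metric : ∀ (p : M) (Y Z : VecField 𝓘(ℝ, E) M) (v : TangentSpace 𝓘(ℝ, E) p),
    SmoothVecAt Y p → SmoothVecAt Z p →
      mvfderiv 𝓘(ℝ, E) (fun x ↦ g x (Y x) (Z x)) p v = g p (D Y p v) (Z p) + g p (Y p) (D Z p v)

/-! ### Lifts to the tangent bundle

In Mathlib the tangent space of `TM` at `u` is `E × E`, through the induced chart `(xⁱ, yⁱ)` of `TM`
that comes from the preferred chart of `M` at the base point of `u`. -/

/-- The tangent space of `TM` at `u`. -/
abbrev TTangent (u : TangentBundle 𝓘(ℝ, E) M) : Type _ := TangentSpace 𝓘(ℝ, E).tangent u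

/-- The vertical lift `w ↦ w^V` at `u`, with components `(0, wᵏ)`. -/
def verticalLift (u : TangentBundle 𝓘(ℝ, E) M) : TangentSpace 𝓘(ℝ, E) u.1 →L[ℝ] TTangent u :=
  (ContinuousLinearMap.inr ℝ E E :)

/-- The map `v ↦ yⁱ Γᵏᵢⱼ vʲ` at the point `u` with fibre coordinates `yⁱ`. It equals `v ↦ ∇_v U`, where
`U = FiberBundle.extend E u.2` is the local vector field with constant components `yⁱ` in the
chart. -/
def christoffel (D : AffineConnection E M) (u : TangentBundle 𝓘(ℝ, E) M) : E →L[ℝ] E :=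
  D (FiberBundle.extend E u.2) u.1

/-- The horizontal lift `v ↦ v^H` at `u`, with components `(vᵏ, -yⁱ Γᵏᵢⱼ vʲ)`. -/
def horizontalLift (D : AffineConnection E M) (u : TangentBundle 𝓘(ℝ, E) M) :
    TangentSpace 𝓘(ℝ, E) u.1 →L[ℝ] TTangent u :=
  ((ContinuousLinearMap.id ℝ E).prod (-christoffel D u) :)

/-- The vector `v` such that `ξ = v^H + w^V`; this is `dπ(ξ)`. -/
def horizontalPart (u : TangentBundle 𝓘(ℝ, E) M) : TTangent u →L[ℝ] TangentSpace 𝓘(ℝ, E) u.1 :=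
  (ContinuousLinearMap.fst ℝ E E :)

/-- The vector `w` such that `ξ = v^H + w^V`. -/
def verticalPart (D : AffineConnection E M) (u : TangentBundle 𝓘(ℝ, E) M) :
    TTangent u →L[ℝ] TangentSpace 𝓘(ℝ, E) u.1 :=
  (ContinuousLinearMap.snd ℝ E E
    + (christoffel D u).comp (ContinuousLinearMap.fst ℝ E E) :)

theorem horizontalLift_add_verticalLift (D : AffineConnection E M) (u : TangentBundle 𝓘(ℝ, E) M)
    (ξ : TTangent u) :
    horizontalLift D u (horizontalPart u ξ) + verticalLift u (verticalPart D u ξ) = ξ := by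
  let Γ : E →L[ℝ] E := christoffel D u
  have h : ∀ ζ : E × E, (ζ.1, -Γ ζ.1) + ((0 : E), ζ.2 + Γ ζ.1) = ζ := by
    intro ζ
    ext <;> simp
  exact h ξ

@[simp] theorem horizontalPart_horizontalLift (D : AffineConnection E M)
    (u : TangentBundle 𝓘(ℝ, E) M) (v : TangentSpace 𝓘(ℝ, E) u.1) :
    horizontalPart u (horizontalLift D u v) = v := rfl

@[simp] theorem horizontalPart_verticalLift
    (u : TangentBundle 𝓘(ℝ, E) M) (w : TangentSpace 𝓘(ℝ, E) u.1) :
    horizontalPart u (verticalLift u w) = 0 := rfl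

@[simp] theorem verticalPart_horizontalLift (D : AffineConnection E M)
    (u : TangentBundle 𝓘(ℝ, E) M) (v : TangentSpace 𝓘(ℝ, E) u.1) :
    verticalPart D u (horizontalLift D u v) = 0 := by
  let Γ : E →L[ℝ] E := christoffel D u
  have h : ∀ x : E, -Γ x + Γ x = 0 := fun x ↦ neg_add_cancel _
  exact h v

@[simp] theorem verticalPart_verticalLift (D : AffineConnection E M)
    (u : TangentBundle 𝓘(ℝ, E) M) (w : TangentSpace 𝓘(ℝ, E) u.1) :
    verticalPart D u (verticalLift u w) = w := by
  let Γ : E →L[ℝ] E := christoffel D u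
  have h : ∀ x : E, x + Γ 0 = x := by simp
  exact h w

/-- `J₁`, determined by `X^H ↦ X^V` and `X^V ↦ -X^H`. -/
def liftJ₁ (D : AffineConnection E M) : EndField 𝓘(ℝ, E).tangent (TangentBundle 𝓘(ℝ, E) M) :=
  fun u ↦ (verticalLift u).comp (horizontalPart u) - (horizontalLift D u).comp (verticalPart D u)

/-- `J₂`, determined by `X^H ↦ (JX)^V` and `X^V ↦ (JX)^H`. -/
def liftJ₂ (D : AffineConnection E M) (J : EndField 𝓘(ℝ, E) M) :
    EndField 𝓘(ℝ, E).tangent (TangentBundle 𝓘(ℝ, E) M) :=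
  fun u ↦ (verticalLift u).comp ((J u.1).comp (horizontalPart u))
    + (horizontalLift D u).comp ((J u.1).comp (verticalPart D u))

/-- `J₃ = J₁ ∘ J₂`. -/
def liftJ₃ (D : AffineConnection E M) (J : EndField 𝓘(ℝ, E) M) :
    EndField 𝓘(ℝ, E).tangent (TangentBundle 𝓘(ℝ, E) M) :=
  fun u ↦ (liftJ₁ D u).comp (liftJ₂ D J u)

theorem liftJ₁_horizontalLift (D : AffineConnection E M) (u : TangentBundle 𝓘(ℝ, E) M)
    (v : TangentSpace 𝓘(ℝ, E) u.1) :
    liftJ₁ D u (horizontalLift D u v) = verticalLift u v := by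
  simp [liftJ₁]

theorem liftJ₁_verticalLift (D : AffineConnection E M) (u : TangentBundle 𝓘(ℝ, E) M)
    (v : TangentSpace 𝓘(ℝ, E) u.1) :
    liftJ₁ D u (verticalLift u v) = -horizontalLift D u v := by
  simp [liftJ₁]

theorem liftJ₂_horizontalLift (D : AffineConnection E M) (J : EndField 𝓘(ℝ, E) M)
    (u : TangentBundle 𝓘(ℝ, E) M) (v : TangentSpace 𝓘(ℝ, E) u.1) :
    liftJ₂ D J u (horizontalLift D u v) = verticalLift u (J u.1 v) := by
  simp [liftJ₂]

theorem liftJ₂_verticalLift (D : AffineConnection E M) (J : EndField 𝓘(ℝ, E) M)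
    (u : TangentBundle 𝓘(ℝ, E) M) (v : TangentSpace 𝓘(ℝ, E) u.1) :
    liftJ₂ D J u (verticalLift u v) = horizontalLift D u (J u.1 v) := by
  simp [liftJ₂]

end Base

end

/-!
Everything is computed in charts. In the preferred chart of `M` at a point the connection is a
function `G`, where `G z y a = yⁱ Γᵏᵢⱼ aʲ` is the derivative `∇_a` of the field with constant
components `y`, and `J` is a function `j` with values in the endomorphisms of the model space `E`.
In the induced chart of `TM`, with points `q = (z, y)`, the lifts are `a^H = (a, -G z y a)` and
`c^V = (0, c)` (`toCoord_horizontalLift`, `toCoord_verticalLift`), so that the three structures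
become explicit endomorphism fields of `E × E`. The Nijenhuis tensor of an almost complex
structure `A` is tensorial, hence equal to a pointwise expression in `A` and its first derivative
(`localNijenhuis`, `nijenhuis_eq`), and integrability is its vanishing at the centre of every
chart (`isIntegrableComplex_iff`).

Write `R` for the curvature and `T_a c = (∇_a J) c`. For a torsion-free connection the local
expressions give, at `(z, y)`,
* `N₁(c^V, d^V) = (R(c, d) y)^V`,
* `N₂(c^V, d^V) = (T_{Jd} c - T_{Jc} d)^H + (R(Jc, Jd) y)^V`,
* `N₃(c^V, d^V) = 0` and `N₃(a^H, d^V) = (J T_a d + T_{Ja} d)^V`, while the vertical part of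
  `N₃(a^H, b^H)` is `R(Ja, Jb) y - R(a, b) y + J (R(Ja, b) y + R(a, Jb) y)`.

As `J₁` and `J₂` interchange the vertical and the horizontal vectors and `N(Ax, y) = -A N(x, y)`,
the tensors `N₁` and `N₂` are determined by their values on vertical vectors. Hence `J₁` is
integrable if and only if `R = 0`, and `J₂` if and only if `R = 0` and `T_{Jd} c = T_{Jc} d`.

For the Levi-Civita connection of a Norden metric every `T_a` is self-adjoint
(`localNabla_selfAdjoint`) and anticommutes with `J` (`localNabla_apply_right`). Under either of
the conditions on `T` imposed by `J₂` and `J₃`, these symmetries force `T = 0`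
(`eq_zero_of_symm_of_anticomm`, `eq_zero_of_anticomm`). In the case of `J₃` the parallelism of `J`
makes `R` commute with `J`; together with the symmetries of a Riemannian curvature tensor, the
condition on `R` leaves only `R = 0` (`curvature_eq_zero`). Conversely, all the terms above vanish
when `R = 0` and `T = 0`. The algebraic part of being hypercomplex holds for every connection.
-/

noncomputable section

/- Tangent spaces carry no norm here; with this instance the search for one is very expensive. -/
attribute [-instance]
  instNormedAddCommGroupOfRiemannianBundleOfIsTopologicalAddGroupOfContinuousConstSMulReal

open Filter Set
open scoped Topology

/-! ### The local model: tensors attached to connection coefficients on a vector space -/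

section LocalModel

variable {E : Type*} [NormedAddCommGroup E] [NormedSpace ℝ E]
  {F : Type*} [NormedAddCommGroup F] [NormedSpace ℝ F]

/-- The pointwise expression of the Nijenhuis tensor of a field `A` of endomorphisms of a vector
space, evaluated at the vectors `x`, `y` based at `q`. It agrees with the definition by brackets when
`A² = -id`. -/
def localNijenhuis (A : F → F →L[ℝ] F) (q x y : F) : F :=
  A q (fderiv ℝ A q x y - fderiv ℝ A q y x) - fderiv ℝ A q (A q x) y + fderiv ℝ A q (A q y) x

theorem localNijenhuis_swap (A : F → F →L[ℝ] F) (q x y : F) :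
    localNijenhuis A q y x = -localNijenhuis A q x y := by
  simp only [localNijenhuis, map_sub]; abel

theorem localNijenhuis_add_left (A : F → F →L[ℝ] F) (q x x' y : F) :
    localNijenhuis A q (x + x') y = localNijenhuis A q x y + localNijenhuis A q x' y := by
  simp only [localNijenhuis, map_sub, map_add, add_apply]; abel

theorem localNijenhuis_add_right (A : F → F →L[ℝ] F) (q x y y' : F) :
    localNijenhuis A q x (y + y') = localNijenhuis A q x y + localNijenhuis A q x y' := by
  simp only [localNijenhuis, map_sub, map_add, add_apply]; abel

/-- Differentiating `A² = -id` shows that `A` anticommutes with its derivatives. -/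
theorem fderiv_apply_apply_of_sq {A : F → F →L[ℝ] F} {q : F} (hA : DifferentiableAt ℝ A q)
    (hsq : ∀ᶠ r in 𝓝 q, ∀ v, A r (A r v) = -v) (x v : F) :
    fderiv ℝ A q x (A q v) = -A q (fderiv ℝ A q x v) := by
  have h1 : HasFDerivAt (fun r ↦ A r (A r v)) _ q :=
    hA.hasFDerivAt.clm_apply (hA.hasFDerivAt.clm_apply (hasFDerivAt_const v q))
  have h2 : HasFDerivAt (fun r ↦ A r (A r v)) (0 : F →L[ℝ] F) q :=
    (hasFDerivAt_const (-v) q).congr_of_eventuallyEq (hsq.mono fun r hr ↦ hr v)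
  have h3 := DFunLike.congr_fun (h1.unique h2) x
  simp at h3
  rw [eq_neg_iff_add_eq_zero, add_comm]
  exact h3

/-- For an almost complex structure the Nijenhuis bracket expression is tensorial. -/
theorem lieBracket_nijenhuis_eq {A : F → F →L[ℝ] F} {q : F} (hA : DifferentiableAt ℝ A q)
    (hsq : ∀ v, A q (A q v) = -v) {X Y : F → F} (hX : DifferentiableAt ℝ X q)
    (hY : DifferentiableAt ℝ Y q) :
    VectorField.lieBracket ℝ X Y q
      + A q (VectorField.lieBracket ℝ (fun r ↦ A r (X r)) Y q)
      + A q (VectorField.lieBracket ℝ X (fun r ↦ A r (Y r)) q)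
      - VectorField.lieBracket ℝ (fun r ↦ A r (X r)) (fun r ↦ A r (Y r)) q
      = localNijenhuis A q (X q) (Y q) := by
  have hAX : fderiv ℝ (fun r ↦ A r (X r)) q = _ :=
    (hA.hasFDerivAt.clm_apply hX.hasFDerivAt).fderiv
  have hAY : fderiv ℝ (fun r ↦ A r (Y r)) q = _ :=
    (hA.hasFDerivAt.clm_apply hY.hasFDerivAt).fderiv
  simp only [VectorField.lieBracket, hAX, hAY, localNijenhuis]
  simp [hsq]
  abel

theorem localNijenhuis_apply_left {A : F → F →L[ℝ] F} {q : F} (hA : DifferentiableAt ℝ A q)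
    (hsq : ∀ᶠ r in 𝓝 q, ∀ v, A r (A r v) = -v) (x y : F) :
    localNijenhuis A q (A q x) y = -A q (localNijenhuis A q x y) := by
  have h := fderiv_apply_apply_of_sq hA hsq
  have hq := hsq.self_of_nhds
  simp only [localNijenhuis, map_sub, map_add, map_neg, h, hq, neg_apply]
  abel

variable (G : E → E →L[ℝ] E →L[ℝ] E) (j : E → E →L[ℝ] E)

/-- The curvature `R(a,b)c` at `z` of the connection with coefficients `G`, where `G z c a` is
the derivative `∇_a c` of the constant field `c`. -/
def localCurvature (z a b c : E) : E :=
  fderiv ℝ G z a c b - fderiv ℝ G z b c a + G z (G z c b) a - G z (G z c a) b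

/-- The covariant derivative `(∇_a j) c` at `z`. -/
def localNabla (z a c : E) : E :=
  fderiv ℝ j z a c + G z (j z c) a - j z (G z c a)

/-- The horizontal lift of `a` at `q = (z, y)`. -/
def localH (q : E × E) : E →L[ℝ] E × E := (ContinuousLinearMap.id ℝ E).prod (-G q.1 q.2)

/-- The vertical component of a vector at `q = (z, y)`. -/
def localV (q : E × E) : E × E →L[ℝ] E :=
  ContinuousLinearMap.snd ℝ E E + (G q.1 q.2).comp (ContinuousLinearMap.fst ℝ E E)

/-- The coordinate expression of `J₁`. -/
def localJ₁ (q : E × E) : E × E →L[ℝ] E × E :=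
  (ContinuousLinearMap.inr ℝ E E).comp (ContinuousLinearMap.fst ℝ E E)
    - (localH G q).comp (localV G q)

/-- The coordinate expression of `J₂`. -/
def localJ₂ (q : E × E) : E × E →L[ℝ] E × E :=
  (ContinuousLinearMap.inr ℝ E E).comp ((j q.1).comp (ContinuousLinearMap.fst ℝ E E))
    + (localH G q).comp ((j q.1).comp (localV G q))

/-- The coordinate expression of `J₃`. -/
def localJ₃ (q : E × E) : E × E →L[ℝ] E × E := (localJ₁ G q).comp (localJ₂ G j q)

variable {G j}

theorem localJ₁_apply (q ξ : E × E) : localJ₁ G q ξ =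
    (-(ξ.2 + G q.1 q.2 ξ.1), ξ.1 + G q.1 q.2 (ξ.2 + G q.1 q.2 ξ.1)) := by
  ext <;> simp [localJ₁, localH, localV]; abel

theorem localJ₂_apply (q ξ : E × E) : localJ₂ G j q ξ =
    (j q.1 (ξ.2 + G q.1 q.2 ξ.1), j q.1 ξ.1 - G q.1 q.2 (j q.1 (ξ.2 + G q.1 q.2 ξ.1))) := by
  ext <;> simp [localJ₂, localH, localV]; abel

theorem localJ₃_apply (q ξ : E × E) : localJ₃ G j q ξ =
    (-j q.1 ξ.1, j q.1 (ξ.2 + G q.1 q.2 ξ.1) + G q.1 q.2 (j q.1 ξ.1)) := by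
  rw [localJ₃, ContinuousLinearMap.comp_apply, localJ₂_apply, localJ₁_apply]
  ext <;> simp

theorem localJ₁_sq (q ξ : E × E) : localJ₁ G q (localJ₁ G q ξ) = -ξ := by
  simp only [localJ₁_apply]; ext <;> simp <;> abel

theorem localJ₂_sq {q : E × E} (hj : ∀ v, j q.1 (j q.1 v) = -v) (ξ : E × E) :
    localJ₂ G j q (localJ₂ G j q ξ) = -ξ := by
  simp only [localJ₂_apply]; ext <;> simp [hj]

section Smooth

variable {n : WithTop ℕ∞} {q : E × E}

theorem contDiffAt_localH (hG : ContDiffAt ℝ n G q.1) : ContDiffAt ℝ n (localH G) q := by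
  have h : ContDiffAt ℝ n (fun r : E × E ↦ G r.1 r.2) q :=
    (hG.comp q contDiffAt_fst).clm_apply contDiffAt_snd
  have h' : localH G = fun r ↦ (ContinuousLinearMap.inl ℝ E E).comp (ContinuousLinearMap.id ℝ E)
      - (ContinuousLinearMap.inr ℝ E E).comp (G r.1 r.2) := by
    ext r a <;> simp [localH]
  rw [h']
  exact contDiffAt_const.sub (contDiffAt_const.clm_comp h)

theorem contDiffAt_localV (hG : ContDiffAt ℝ n G q.1) : ContDiffAt ℝ n (localV G) q := by
  have h : ContDiffAt ℝ n (fun r : E × E ↦ G r.1 r.2) q :=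
    (hG.comp q contDiffAt_fst).clm_apply contDiffAt_snd
  exact contDiffAt_const.add (h.clm_comp contDiffAt_const)

theorem contDiffAt_localJ₁ (hG : ContDiffAt ℝ n G q.1) : ContDiffAt ℝ n (localJ₁ G) q :=
  contDiffAt_const.sub ((contDiffAt_localH hG).clm_comp (contDiffAt_localV hG))

theorem contDiffAt_localJ₂ (hG : ContDiffAt ℝ n G q.1) (hj : ContDiffAt ℝ n j q.1) :
    ContDiffAt ℝ n (localJ₂ G j) q := by
  have h : ContDiffAt ℝ n (fun r : E × E ↦ j r.1) q := hj.comp q contDiffAt_fst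
  exact (contDiffAt_const.clm_comp (h.clm_comp contDiffAt_const)).add
    ((contDiffAt_localH hG).clm_comp (h.clm_comp (contDiffAt_localV hG)))

theorem contDiffAt_localJ₃ (hG : ContDiffAt ℝ n G q.1) (hj : ContDiffAt ℝ n j q.1) :
    ContDiffAt ℝ n (localJ₃ G j) q :=
  (contDiffAt_localJ₁ hG).clm_comp (contDiffAt_localJ₂ hG hj)

end Smooth

/-! ### The Nijenhuis tensors of the local models -/

section NijenhuisModels

variable {q : E × E}

theorem fderiv_localJ₁_apply (hG : ContDiffAt ℝ 1 G q.1) (ζ ξ : E × E) :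
    fderiv ℝ (localJ₁ G) q ζ ξ =
      (-(fderiv ℝ G q.1 ζ.1 q.2 ξ.1 + G q.1 ζ.2 ξ.1),
        fderiv ℝ G q.1 ζ.1 q.2 (ξ.2 + G q.1 q.2 ξ.1) + G q.1 ζ.2 (ξ.2 + G q.1 q.2 ξ.1)
          + G q.1 q.2 (fderiv ℝ G q.1 ζ.1 q.2 ξ.1 + G q.1 ζ.2 ξ.1)) := by
  have hJ := ((contDiffAt_localJ₁ hG).differentiableAt one_ne_zero).hasFDerivAt
  have hJξ := hJ.clm_apply (hasFDerivAt_const ξ q)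
  have hGd := (hG.differentiableAt one_ne_zero).hasFDerivAt
  have hg : HasFDerivAt (fun r : E × E ↦ G r.1 r.2) _ q :=
    (hGd.comp q hasFDerivAt_fst).clm_apply hasFDerivAt_snd
  have hb : HasFDerivAt (fun r : E × E ↦ ξ.2 + G r.1 r.2 ξ.1) _ q :=
    (hg.clm_apply (hasFDerivAt_const ξ.1 q)).const_add ξ.2
  have hf : HasFDerivAt (fun r : E × E ↦ (-(ξ.2 + G r.1 r.2 ξ.1),
      ξ.1 + G r.1 r.2 (ξ.2 + G r.1 r.2 ξ.1))) _ q :=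
    hb.neg.prodMk ((hg.clm_apply hb).const_add ξ.1)
  have he := hf.congr_of_eventuallyEq
    (Filter.Eventually.of_forall fun r ↦ localJ₁_apply (G := G) r ξ)
  have := DFunLike.congr_fun (hJξ.unique he) ζ
  simp at this
  rw [this]
  ext <;> simp <;> abel

theorem fderiv_localJ₂_apply (hG : ContDiffAt ℝ 1 G q.1) (hj : ContDiffAt ℝ 1 j q.1)
    (ζ : E × E) (d : E) :
    fderiv ℝ (localJ₂ G j) q ζ (0, d) =
      (fderiv ℝ j q.1 ζ.1 d, -(fderiv ℝ G q.1 ζ.1 q.2 (j q.1 d) + G q.1 ζ.2 (j q.1 d)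
          + G q.1 q.2 (fderiv ℝ j q.1 ζ.1 d))) := by
  have hJ := ((contDiffAt_localJ₂ hG hj).differentiableAt one_ne_zero).hasFDerivAt
  have hJξ := hJ.clm_apply (hasFDerivAt_const ((0, d) : E × E) q)
  have hGd := (hG.differentiableAt one_ne_zero).hasFDerivAt
  have hg : HasFDerivAt (fun r : E × E ↦ G r.1 r.2) _ q :=
    (hGd.comp q hasFDerivAt_fst).clm_apply hasFDerivAt_snd
  have hjd : HasFDerivAt (fun r : E × E ↦ j r.1 d) _ q :=
    (((hj.differentiableAt one_ne_zero).hasFDerivAt).comp q hasFDerivAt_fst).clm_apply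
      (hasFDerivAt_const d q)
  have hf : HasFDerivAt (fun r : E × E ↦ (j r.1 d, -G r.1 r.2 (j r.1 d))) _ q :=
    hjd.prodMk (hg.clm_apply hjd).neg
  have he := hf.congr_of_eventuallyEq (Filter.Eventually.of_forall fun r ↦
    (show localJ₂ G j r (0, d) = _ by simp [localJ₂_apply]))
  have := DFunLike.congr_fun (hJξ.unique he) ζ
  simp at this
  rw [this]
  ext <;> simp; abel

theorem fderiv_localJ₃_apply (hG : ContDiffAt ℝ 1 G q.1) (hj : ContDiffAt ℝ 1 j q.1)
    (ζ ξ : E × E) :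
    fderiv ℝ (localJ₃ G j) q ζ ξ =
      (-fderiv ℝ j q.1 ζ.1 ξ.1,
        fderiv ℝ j q.1 ζ.1 (ξ.2 + G q.1 q.2 ξ.1)
          + j q.1 (fderiv ℝ G q.1 ζ.1 q.2 ξ.1 + G q.1 ζ.2 ξ.1)
          + fderiv ℝ G q.1 ζ.1 q.2 (j q.1 ξ.1) + G q.1 ζ.2 (j q.1 ξ.1)
          + G q.1 q.2 (fderiv ℝ j q.1 ζ.1 ξ.1)) := by
  have hJ := ((contDiffAt_localJ₃ hG hj).differentiableAt one_ne_zero).hasFDerivAt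
  have hJξ := hJ.clm_apply (hasFDerivAt_const ξ q)
  have hGd := (hG.differentiableAt one_ne_zero).hasFDerivAt
  have hg : HasFDerivAt (fun r : E × E ↦ G r.1 r.2) _ q :=
    (hGd.comp q hasFDerivAt_fst).clm_apply hasFDerivAt_snd
  have hb : HasFDerivAt (fun r : E × E ↦ ξ.2 + G r.1 r.2 ξ.1) _ q :=
    (hg.clm_apply (hasFDerivAt_const ξ.1 q)).const_add ξ.2
  have hj' : HasFDerivAt (fun r : E × E ↦ j r.1) _ q :=
    ((hj.differentiableAt one_ne_zero).hasFDerivAt).comp q hasFDerivAt_fst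
  have hja := hj'.clm_apply (hasFDerivAt_const ξ.1 q)
  have hf : HasFDerivAt (fun r : E × E ↦ (-j r.1 ξ.1,
      j r.1 (ξ.2 + G r.1 r.2 ξ.1) + G r.1 r.2 (j r.1 ξ.1))) _ q :=
    hja.neg.prodMk ((hj'.clm_apply hb).add (hg.clm_apply hja))
  have he := hf.congr_of_eventuallyEq
    (Filter.Eventually.of_forall fun r ↦ localJ₃_apply (G := G) (j := j) r ξ)
  have := DFunLike.congr_fun (hJξ.unique he) ζ
  simp at this
  rw [this]
  ext <;> simp; abel

/-- `N₁(c^V, d^V) = (R(c, d) y)^V`. -/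
theorem localNijenhuis_localJ₁_vertical (hG : ContDiffAt ℝ 1 G q.1)
    (hs : ∀ a b, G q.1 a b = G q.1 b a) (c d : E) :
    localNijenhuis (localJ₁ G) q (0, c) (0, d) = (0, localCurvature G q.1 c d q.2) := by
  simp only [localNijenhuis, fderiv_localJ₁_apply hG, localJ₁_apply, localCurvature]
  ext
  · simp [hs c d]
  · simp [hs c d]; abel

/-- `N₂(c^V, d^V) = (T_{jd} c - T_{jc} d)^H + (R(jc, jd) y)^V`, where `T = ∇j`. -/
theorem localNijenhuis_localJ₂_vertical (hG : ContDiffAt ℝ 1 G q.1) (hj : ContDiffAt ℝ 1 j q.1)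
    (hs : ∀ a b, G q.1 a b = G q.1 b a) (c d : E) :
    localNijenhuis (localJ₂ G j) q (0, c) (0, d) =
      localH G q (localNabla G j q.1 (j q.1 d) c - localNabla G j q.1 (j q.1 c) d)
        + (0, localCurvature G q.1 (j q.1 c) (j q.1 d) q.2) := by
  have h1 := hs (j q.1 c) (j q.1 d)
  have h2 := hs c (j q.1 d)
  have h3 := hs d (j q.1 c)
  simp only [localNijenhuis, fderiv_localJ₂_apply hG hj, localJ₂_apply, localCurvature,
    localNabla, localH]
  ext
  · simp [h1, h2, h3]; abel
  · simp [h1, h2, h3]; abel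

theorem localNijenhuis_localJ₃_vertical (hG : ContDiffAt ℝ 1 G q.1) (hj : ContDiffAt ℝ 1 j q.1)
    (c d : E) : localNijenhuis (localJ₃ G j) q (0, c) (0, d) = 0 := by
  simp only [localNijenhuis, fderiv_localJ₃_apply hG hj, localJ₃_apply]
  ext <;> simp

/-- `N₃(a^H, d^V) = (j T_a d + T_{ja} d)^V`, where `T = ∇j`. -/
theorem localNijenhuis_localJ₃_mixed (hG : ContDiffAt ℝ 1 G q.1) (hj : ContDiffAt ℝ 1 j q.1)
    (hsq : ∀ v, j q.1 (j q.1 v) = -v) (a d : E) :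
    localNijenhuis (localJ₃ G j) q (localH G q a) (0, d) =
      (0, j q.1 (localNabla G j q.1 a d) + localNabla G j q.1 (j q.1 a) d) := by
  simp only [localNijenhuis, fderiv_localJ₃_apply hG hj, localJ₃_apply, localNabla, localH]
  ext
  · simp
  · simp [hsq]; abel

/-- The horizontal part of `N₃(a^H, b^H)` is the Nijenhuis tensor of `j`; its vertical part is a
combination of curvatures. -/
theorem localNijenhuis_localJ₃_horizontal (hG : ContDiffAt ℝ 1 G q.1)
    (hj : ContDiffAt ℝ 1 j q.1) (hsq : ∀ v, j q.1 (j q.1 v) = -v) (a b : E) :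
    localNijenhuis (localJ₃ G j) q (localH G q a) (localH G q b) =
      localH G q (localNijenhuis j q.1 a b)
        + (0, localCurvature G q.1 (j q.1 a) (j q.1 b) q.2 - localCurvature G q.1 a b q.2
          + j q.1 (localCurvature G q.1 (j q.1 a) b q.2
            + localCurvature G q.1 a (j q.1 b) q.2)) := by
  simp only [localNijenhuis, fderiv_localJ₃_apply hG hj, localJ₃_apply, localCurvature, localH]
  ext
  · simp; abel
  · simp [hsq]; abel

end NijenhuisModels

/-! ### Vanishing of the Nijenhuis tensors of the local models -/

/-- Since `N(Ax, y) = -A N(x, y)`, the Nijenhuis tensor is determined by its values on any set `P`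
that together with its image under `A` generates the space. -/
theorem localNijenhuis_eq_zero_of_forall_mem {A : F → F →L[ℝ] F} {q : F}
    (hA : DifferentiableAt ℝ A q) (hsq : ∀ᶠ r in 𝓝 q, ∀ v, A r (A r v) = -v) {P : Set F}
    (hP : ∀ x, ∃ v ∈ P, ∃ w ∈ P, x = v + A q w)
    (h : ∀ v ∈ P, ∀ w ∈ P, localNijenhuis A q v w = 0) (x y : F) :
    localNijenhuis A q x y = 0 := by
  have key : ∀ w ∈ P, ∀ x, localNijenhuis A q x w = 0 := by
    intro w hw x
    obtain ⟨v, hv, v', hv', rfl⟩ := hP x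
    rw [localNijenhuis_add_left, h v hv w hw, localNijenhuis_apply_left hA hsq, h v' hv' w hw]
    simp
  obtain ⟨v, hv, v', hv', rfl⟩ := hP y
  rw [localNijenhuis_add_right, key v hv, localNijenhuis_swap,
    localNijenhuis_apply_left hA hsq, localNijenhuis_swap, key v' hv']
  simp

section Vanishing

variable {q : E × E}

/-- `J₁` maps the vertical vectors onto the horizontal ones, so that the vertical ones suffice to
test `N₁ = 0`. -/
theorem localNijenhuis_localJ₁_eq_zero_iff (hG : ContDiffAt ℝ 1 G q.1)
    (hs : ∀ a b, G q.1 a b = G q.1 b a) :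
    (∀ ξ η, localNijenhuis (localJ₁ G) q ξ η = 0) ↔
      ∀ c d, localCurvature G q.1 c d q.2 = 0 := by
  constructor
  · intro h c d
    have := h (0, c) (0, d)
    rw [localNijenhuis_localJ₁_vertical hG hs] at this
    exact congrArg Prod.snd this
  · intro h
    refine localNijenhuis_eq_zero_of_forall_mem (P := Set.range fun c : E ↦ ((0, c) : E × E))
      ((contDiffAt_localJ₁ hG).differentiableAt one_ne_zero)
      (Filter.Eventually.of_forall fun r v ↦ localJ₁_sq r v) ?_ ?_
    · intro ξ
      refine ⟨_, ⟨ξ.2 + G q.1 q.2 ξ.1, rfl⟩, _, ⟨-ξ.1, rfl⟩, ?_⟩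
      rw [localJ₁_apply]
      ext <;> simp
    · rintro _ ⟨c, rfl⟩ _ ⟨d, rfl⟩
      simp only
      rw [localNijenhuis_localJ₁_vertical hG hs, h]
      rfl

theorem localNijenhuis_localJ₂_eq_zero_iff (hG : ContDiffAt ℝ 1 G q.1)
    (hj : ContDiffAt ℝ 1 j q.1) (hs : ∀ a b, G q.1 a b = G q.1 b a)
    (hsq : ∀ᶠ z in 𝓝 q.1, ∀ v, j z (j z v) = -v) :
    (∀ ξ η, localNijenhuis (localJ₂ G j) q ξ η = 0) ↔
      (∀ c d, localCurvature G q.1 c d q.2 = 0) ∧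
        ∀ c d, localNabla G j q.1 (j q.1 d) c = localNabla G j q.1 (j q.1 c) d := by
  have hq := hsq.self_of_nhds
  constructor
  · intro h
    have h1 : ∀ c d, localNabla G j q.1 (j q.1 d) c = localNabla G j q.1 (j q.1 c) d := by
      intro c d
      have := h (0, c) (0, d)
      rw [localNijenhuis_localJ₂_vertical hG hj hs] at this
      have := congrArg Prod.fst this
      simpa [localH, sub_eq_zero] using this
    refine ⟨fun c d ↦ ?_, h1⟩
    -- `-jc` and `-jd` are the vectors that `j` maps to `c` and `d`.
    have := h (0, -j q.1 c) (0, -j q.1 d)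
    rw [localNijenhuis_localJ₂_vertical hG hj hs, h1, sub_self] at this
    have := congrArg Prod.snd this
    simpa [hq] using this
  · rintro ⟨h, h1⟩
    refine localNijenhuis_eq_zero_of_forall_mem (P := Set.range fun c : E ↦ ((0, c) : E × E))
      ((contDiffAt_localJ₂ hG hj).differentiableAt one_ne_zero)
      ((continuous_fst.tendsto q).eventually hsq |>.mono fun r hr v ↦ localJ₂_sq hr v) ?_ ?_
    · intro ξ
      refine ⟨_, ⟨ξ.2 + G q.1 q.2 ξ.1, rfl⟩, _, ⟨-j q.1 ξ.1, rfl⟩, ?_⟩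
      rw [localJ₂_apply]
      ext <;> simp [hq]
    · rintro _ ⟨c, rfl⟩ _ ⟨d, rfl⟩
      simp only
      rw [localNijenhuis_localJ₂_vertical hG hj hs, h, h1]
      simp

/-- The values on vertical vectors do not determine `N₃`, since `J₃` preserves the vertical subspace:
all combinations of horizontal and vertical arguments are needed. -/
theorem localNijenhuis_localJ₃_eq_zero (hG : ContDiffAt ℝ 1 G q.1)
    (hj : ContDiffAt ℝ 1 j q.1) (hs : ∀ a b, G q.1 a b = G q.1 b a)
    (hsq : ∀ v, j q.1 (j q.1 v) = -v)
    (hR : ∀ c d, localCurvature G q.1 c d q.2 = 0) (hT : ∀ a c, localNabla G j q.1 a c = 0)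
    (ξ η : E × E) : localNijenhuis (localJ₃ G j) q ξ η = 0 := by
  -- The Nijenhuis tensor of a parallel structure vanishes, the connection being torsion-free.
  have hN : ∀ a b, localNijenhuis j q.1 a b = 0 := by
    intro a b
    have h : ∀ a c, fderiv ℝ j q.1 a c = j q.1 (G q.1 c a) - G q.1 (j q.1 c) a := by
      intro a c
      have := hT a c
      rw [localNabla, sub_eq_zero, ← eq_sub_iff_add_eq] at this
      exact this
    simp only [localNijenhuis, h, map_sub, hsq, hs (j q.1 b) (j q.1 a), hs a b, hs (j q.1 a) b,
      hs (j q.1 b) a]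
    abel
  have hHH : ∀ a b, localNijenhuis (localJ₃ G j) q (localH G q a) (localH G q b) = 0 := by
    intro a b
    rw [localNijenhuis_localJ₃_horizontal hG hj hsq, hN]
    simp [hR]
  have hHV : ∀ a d, localNijenhuis (localJ₃ G j) q (localH G q a) (0, d) = 0 := by
    intro a d
    rw [localNijenhuis_localJ₃_mixed hG hj hsq]
    simp [hT]
  have dec : ∀ ξ : E × E, ξ = localH G q ξ.1 + (0, localV G q ξ) := by
    intro ξ
    ext <;> simp [localH, localV]
  rw [dec ξ, dec η, localNijenhuis_add_left, localNijenhuis_add_right, localNijenhuis_add_right,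
    hHH, hHV, localNijenhuis_swap, hHV, localNijenhuis_localJ₃_vertical hG hj]
  simp

end Vanishing

/-! ### Identities for the curvature and for the covariant derivative of an endomorphism field -/

section Identities

variable {z : E}

theorem localCurvature_neg_right (a b c : E) :
    localCurvature G z a (-b) c = -localCurvature G z a b c := by
  simp [localCurvature]; abel

theorem localCurvature_swap (a b c : E) :
    localCurvature G z b a c = -localCurvature G z a b c := by
  simp [localCurvature]; abel

/-- The first Bianchi identity. -/
theorem localCurvature_bianchi (hG : DifferentiableAt ℝ G z)
    (hs : ∀ᶠ w in 𝓝 z, ∀ a b, G w a b = G w b a) (a b c : E) :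
    localCurvature G z a b c + localCurvature G z b c a + localCurvature G z c a b = 0 := by
  have hd : ∀ a b c, fderiv ℝ G z a b c = fderiv ℝ G z a c b := by
    intro a b c
    have h : ∀ b c, HasFDerivAt (fun w ↦ G w b c) _ z := fun b c ↦
      (hG.hasFDerivAt.clm_apply (hasFDerivAt_const b z)).clm_apply (hasFDerivAt_const c z)
    have := DFunLike.congr_fun ((h b c).unique
      ((h c b).congr_of_eventuallyEq (hs.mono fun w hw ↦ hw b c))) a
    simpa using this
  have hz := hs.self_of_nhds
  simp only [localCurvature, hd a b c, hd b c a, hd c a b, hz c b, hz a c, hz b a]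
  abel

theorem fderiv_bilin_apply {g : E → E →L[ℝ] E →L[ℝ] ℝ} (hg : DifferentiableAt ℝ g z) (a c d : E) :
    fderiv ℝ g z a c d = fderiv ℝ (fun x ↦ g x c d) z a := by
  rw [((hg.hasFDerivAt.clm_apply (hasFDerivAt_const c z)).clm_apply
    (hasFDerivAt_const d z)).fderiv]
  simp

/-- Differentiating the metric compatibility once more, the symmetry of second derivatives gives
the skew-symmetry of the curvature endomorphisms. -/
theorem localCurvature_skew {g : E → E →L[ℝ] E →L[ℝ] ℝ} (hG : DifferentiableAt ℝ G z)
    (hg : ContDiffAt ℝ 2 g z)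
    (hm : ∀ᶠ w in 𝓝 z, ∀ a c d,
      fderiv ℝ (fun x ↦ g x c d) w a = g w (G w c a) d + g w c (G w d a))
    (a b c d : E) :
    g z (localCurvature G z a b c) d + g z c (localCurvature G z a b d) = 0 := by
  have hgd : HasFDerivAt g _ z := (hg.differentiableAt two_ne_zero).hasFDerivAt
  have hφ : ContDiffAt ℝ 2 (fun x ↦ g x c d) z :=
    (hg.clm_apply contDiffAt_const).clm_apply contDiffAt_const
  have hφ2 : HasFDerivAt (fderiv ℝ fun x ↦ g x c d) _ z :=
    ((hφ.fderiv_right (m := 1) (by norm_num)).differentiableAt one_ne_zero).hasFDerivAt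
  have hsymm : IsSymmSndFDerivAt ℝ (fun x ↦ g x c d) z := hφ.isSymmSndFDerivAt (by simp)
  have hGd : ∀ x y, HasFDerivAt (fun w ↦ G w x y) _ z := fun x y ↦
    (hG.hasFDerivAt.clm_apply (hasFDerivAt_const x z)).clm_apply (hasFDerivAt_const y z)
  have key : ∀ a b, fderiv ℝ (fderiv ℝ fun x ↦ g x c d) z b a =
      (g z (G z (G z c a) b) d + g z (G z c a) (G z d b)) + g z (fderiv ℝ G z b c a) d
      + ((g z (G z c b) (G z d a) + g z c (G z (G z d a) b)) + g z c (fderiv ℝ G z b d a)) := by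
    intro a b
    have h1 := hφ2.clm_apply (hasFDerivAt_const a z)
    have h2 := ((hgd.clm_apply (hGd c a)).clm_apply (hasFDerivAt_const d z)).add
      ((hgd.clm_apply (hasFDerivAt_const c z)).clm_apply (hGd d a))
    have := DFunLike.congr_fun (h1.unique (h2.congr_of_eventuallyEq
      (hm.mono fun w hw ↦ hw a c d))) b
    simp [fderiv_bilin_apply hgd.differentiableAt, hm.self_of_nhds] at this
    rw [this]
    abel
  have h' : fderiv ℝ (fderiv ℝ fun x ↦ g x c d) z a b = fderiv ℝ (fderiv ℝ fun x ↦ g x c d) z b a :=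
    hsymm.eq a b
  rw [key, key] at h'
  simp only [localCurvature, map_add, map_sub, add_apply, sub_apply]
  linear_combination h'

/-- If `∇j = 0` near `z`, then the curvature endomorphisms commute with `j`. -/
theorem localCurvature_apply_comm (hG : DifferentiableAt ℝ G z) (hj : ContDiffAt ℝ 2 j z)
    (hT : ∀ᶠ w in 𝓝 z, ∀ a c, localNabla G j w a c = 0) (a b c : E) :
    localCurvature G z a b (j z c) = j z (localCurvature G z a b c) := by
  have hjd : HasFDerivAt j _ z := (hj.differentiableAt two_ne_zero).hasFDerivAt
  have hj2 : HasFDerivAt (fderiv ℝ j) _ z :=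
    ((hj.fderiv_right (m := 1) (by norm_num)).differentiableAt one_ne_zero).hasFDerivAt
  have hsymm : IsSymmSndFDerivAt ℝ j z := hj.isSymmSndFDerivAt (by simp)
  have hT' : ∀ᶠ w in 𝓝 z, ∀ a c, fderiv ℝ j w a c = j w (G w c a) - G w (j w c) a := by
    filter_upwards [hT] with w hw a c
    have := hw a c
    rwa [localNabla, sub_eq_zero, ← eq_sub_iff_add_eq] at this
  have hGd : ∀ x y, HasFDerivAt (fun w ↦ G w x y) _ z := fun x y ↦
    (hG.hasFDerivAt.clm_apply (hasFDerivAt_const x z)).clm_apply (hasFDerivAt_const y z)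
  have key : ∀ a b, fderiv ℝ (fderiv ℝ j) z b a c =
      (j z (G z (G z c a) b) - G z (j z (G z c a)) b) + j z (fderiv ℝ G z b c a)
      - ((G z (j z (G z c b)) a - G z (G z (j z c) b) a) + fderiv ℝ G z b (j z c) a) := by
    intro a b
    have h1 := (hj2.clm_apply (hasFDerivAt_const a z)).clm_apply (hasFDerivAt_const c z)
    have h2 := (hjd.clm_apply (hGd c a)).sub ((hG.hasFDerivAt.clm_apply
      (hjd.clm_apply (hasFDerivAt_const c z))).clm_apply (hasFDerivAt_const a z))
    have := DFunLike.congr_fun (h1.unique (h2.congr_of_eventuallyEq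
      (hT'.mono fun w hw ↦ hw a c))) b
    simp [hT'.self_of_nhds] at this
    rw [this]
    abel
  have h' : fderiv ℝ (fderiv ℝ j) z a b c = fderiv ℝ (fderiv ℝ j) z b a c := by
    rw [hsymm.eq a b]
  rw [key, key] at h'
  simp only [localCurvature, map_add, map_sub]
  rw [← sub_eq_zero] at h' ⊢
  rw [← neg_eq_zero, ← h']
  abel

/-- The covariant derivative of an almost complex structure anticommutes with it. -/
theorem localNabla_apply_right (hj : DifferentiableAt ℝ j z)
    (hsq : ∀ᶠ w in 𝓝 z, ∀ v, j w (j w v) = -v) (a c : E) :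
    localNabla G j z a (j z c) = -j z (localNabla G j z a c) := by
  have hz := hsq.self_of_nhds
  simp only [localNabla, map_sub, map_add, hz, fderiv_apply_apply_of_sq hj hsq, map_neg, neg_apply]
  abel

theorem apply_comm_of_anti {g : E →L[ℝ] E →L[ℝ] ℝ} {k : E →L[ℝ] E}
    (hk : ∀ v, k (k v) = -v) (ha : ∀ v w, g (k v) (k w) = -g v w) (v w : E) :
    g (k v) w = g v (k w) := by
  have := ha v (k w)
  rw [hk, map_neg] at this
  linarith

/-- If `j` is an anti-isometry of a metric that `∇` preserves, then `∇_a j` is self-adjoint. -/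
theorem localNabla_selfAdjoint {g : E → E →L[ℝ] E →L[ℝ] ℝ} (hj : DifferentiableAt ℝ j z)
    (hg : DifferentiableAt ℝ g z)
    (hm : ∀ a c d, fderiv ℝ (fun x ↦ g x c d) z a = g z (G z c a) d + g z c (G z d a))
    (ha : ∀ᶠ w in 𝓝 z, ∀ c d, g w (j w c) d = g w c (j w d)) (a c d : E) :
    g z (localNabla G j z a c) d = g z c (localNabla G j z a d) := by
  have hjd : ∀ x, HasFDerivAt (fun w ↦ j w x) _ z := fun x ↦
    hj.hasFDerivAt.clm_apply (hasFDerivAt_const x z)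
  have h1 := (hg.hasFDerivAt.clm_apply (hjd c)).clm_apply (hasFDerivAt_const d z)
  have h2 := (hg.hasFDerivAt.clm_apply (hasFDerivAt_const c z)).clm_apply (hjd d)
  have := DFunLike.congr_fun (h1.unique (h2.congr_of_eventuallyEq
    (ha.mono fun w hw ↦ hw c d))) a
  simp [fderiv_bilin_apply hg, hm] at this
  have hz := ha.self_of_nhds
  simp only [localNabla, map_add, map_sub, add_apply, sub_apply]
  linear_combination this - hz (G z c a) d - (hz c (G z d a))

end Identities

/-! ### Norden linear algebra -/

section NordenAlgebra

variable {g : E →L[ℝ] E →L[ℝ] ℝ} {k : E →L[ℝ] E}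

/-- If `T(kd, c)` is symmetric in `c`, `d`, then `g(T(ka, b), c)` is totally symmetric, while moving
`k` from one of its last two arguments to the other changes the sign; moving it around all three
arguments gives zero. -/
theorem eq_zero_of_symm_of_anticomm {T : E → E → E}
    (hsym : ∀ v w, g v w = g w v) (hnd : ∀ v, (∀ w, g v w = 0) → v = 0)
    (hk : ∀ v, k (k v) = -v) (hg : ∀ v w, g (k v) w = g v (k w))
    (hTk : ∀ a c, T a (k c) = -k (T a c)) (hTg : ∀ a c d, g (T a c) d = g c (T a d))
    (h : ∀ c d, T (k d) c = T (k c) d) (a c : E) : T a c = 0 := by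
  have s23 : ∀ a b c, g (T (k a) b) c = g (T (k a) c) b := fun a b c ↦ by rw [hTg, hsym]
  have s12 : ∀ a b c, g (T (k a) b) c = g (T (k b) a) c := fun a b c ↦ by rw [h]
  have m23 : ∀ a b c, g (T (k a) (k b)) c = -g (T (k a) b) (k c) := fun a b c ↦ by
    rw [hTk, map_neg, neg_apply, hg]
  have zero : ∀ a b c, g (T (k a) b) (k c) = 0 := by
    intro a b c
    -- Moving `k` from the first argument to the third costs a sign, but none by way of the second.
    have e1 : g (T (k (k a)) b) c = -g (T (k a) b) (k c) := by
      rw [s12, m23, s12]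
    have e2 : g (T (k (k a)) b) c = g (T (k a) b) (k c) := by
      rw [s23, s12, m23, s12 c a (k b), s23, m23, neg_neg]
    linarith
  refine hnd _ fun w ↦ ?_
  have := zero (-k a) c (-k w)
  simpa [hk] using this

/-- If `T(ka, ·) = -k T(a, ·)`, then `g(T(ka, b), c)` is both symmetric and skew-symmetric in `b`
and `c`. -/
theorem eq_zero_of_anticomm {T : E → E → E}
    (hsym : ∀ v w, g v w = g w v) (hnd : ∀ v, (∀ w, g v w = 0) → v = 0)
    (hk : ∀ v, k (k v) = -v) (hg : ∀ v w, g (k v) w = g v (k w))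
    (hTk : ∀ a c, T a (k c) = -k (T a c)) (hTg : ∀ a c d, g (T a c) d = g c (T a d))
    (h : ∀ a d, k (T a d) + T (k a) d = 0) (a c : E) : T a c = 0 := by
  have h' : ∀ a d, T (k a) d = T a (k d) := fun a d ↦ by
    rw [hTk, eq_neg_iff_add_eq_zero, add_comm, h]
  have zero : ∀ a b c, g (T (k a) b) c = 0 := by
    intro a b c
    have e1 : g (T (k a) b) c = g (T (k a) c) b := by rw [hTg, hsym]
    have e2 : g (T (k a) b) c = -g (T (k a) c) b := by
      rw [h', hTg, hg, h', hTk, map_neg, neg_apply, neg_neg, hsym]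
    linarith
  refine hnd _ fun w ↦ ?_
  have := zero (-k a) c w
  simpa [hk] using this

/-- An algebraic curvature tensor of a Norden metric that commutes with `k` satisfies
`R(ka, b) = R(a, kb)` by pair symmetry. The integrability condition `h` then becomes
`R(ka, b) = -k R(a, b)`, and the Bianchi identity at `(ka, b, c)` leaves only `R = 0`. -/
theorem curvature_eq_zero {R : E → E → E → E}
    (hsym : ∀ v w, g v w = g w v) (hnd : ∀ v, (∀ w, g v w = 0) → v = 0)
    (hk : ∀ v, k (k v) = -v) (hg : ∀ v w, g (k v) w = g v (k w))
    (hneg : ∀ a b c, R a (-b) c = -R a b c) (hswap : ∀ a b c, R b a c = -R a b c)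
    (hB : ∀ a b c, R a b c + R b c a + R c a b = 0)
    (hskew : ∀ a b c d, g (R a b c) d + g c (R a b d) = 0)
    (hcomm : ∀ a b c, R a b (k c) = k (R a b c))
    (h : ∀ a b c, R (k a) (k b) c - R a b c + k (R (k a) b c + R a (k b) c) = 0)
    (a b c : E) : R a b c = 0 := by
  -- Pair symmetry, as for every Riemannian curvature tensor: combine the four Bianchi identities on
  -- three of `a`, `b`, `c`, `d`.
  have hpair : ∀ a b c d, g (R a b c) d = g (R c d a) b := by
    intro a b c d
    have B : ∀ a b c d, g (R a b c) d + g (R b c a) d + g (R c a b) d = 0 := by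
      intro a b c d
      have := congrArg (fun v ↦ g v d) (hB a b c)
      simpa using this
    have S : ∀ a b c d, g (R b a c) d = -g (R a b c) d := by
      intro a b c d
      rw [hswap, map_neg, neg_apply]
    have K : ∀ a b c d, g (R a b d) c = -g (R a b c) d := by
      intro a b c d
      have := hskew a b c d
      rw [hsym c] at this
      linarith
    linarith [B a b c d, B b c d a, B c d a b, B d a b c, S a b c d, S b c d a, S c d a b,
      S d a b c, K a b c d, K b c d a, K c d a b, K d a b c, K c a b d, S c a b d, K b d a c,
      S b d a c, K d b a c, K a c b d]
  have hmove : ∀ a b c, R (k a) b c = R a (k b) c := by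
    intro a b c
    rw [← sub_eq_zero]
    refine hnd _ fun d ↦ ?_
    rw [map_sub, sub_apply, hpair (k a), hpair a, hcomm, hg, sub_self]
  have hkR : ∀ a b c, R (k a) b c = -k (R a b c) := by
    intro a b c
    have h1 := h a b c
    rw [hmove a (k b), hk, hneg, ← hmove] at h1
    have h2 : R a b c = k (R (k a) b c) := by
      have : (2 : ℝ) • (k (R (k a) b c) - R a b c) = 0 := by
        rw [← h1, map_add, two_smul]; abel
      rw [smul_eq_zero, sub_eq_zero] at this
      exact (this.resolve_left two_ne_zero).symm
    rw [h2, hk, neg_neg]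
  have h1 := hB (k c) a b
  rw [hkR, hcomm, ← hmove, hkR] at h1
  have h2 : (2 : ℝ) • k (R a b c) = 0 := by
    have h3 : R c a b + R b c a = -R a b c := by
      rw [eq_neg_iff_add_eq_zero, ← hB a b c]; abel
    have h4 : k (R c a b) + k (R b c a) = -k (R a b c) := by rw [← map_add, h3, map_neg]
    rw [two_smul, ← h1]
    have : k (R a b c) = -(k (R c a b) + k (R b c a)) := by rw [h4, neg_neg]
    nth_rewrite 1 [this]
    abel
  have h5 := (smul_eq_zero.mp h2).resolve_left two_ne_zero
  have := congrArg k h5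
  rw [hk, map_zero, neg_eq_zero] at this
  exact this

end NordenAlgebra

end LocalModel

/-! ### Vector fields and endomorphism fields in a chart -/

section Coordinates

variable {F : Type*} [NormedAddCommGroup F] [NormedSpace ℝ F]
  {K : Type*} [TopologicalSpace K] {I : ModelWithCorners ℝ F K}
  {N : Type*} [TopologicalSpace N] [ChartedSpace K N] [IsManifold I ∞ N]

variable (I) in
/-- The components of a tangent vector at `p` in the preferred chart at `p₀` (zero if `p` is
not in the domain of that chart). -/
def toCoord (p₀ p : N) : TangentSpace I p →L[ℝ] F :=
  (trivializationAt F (TangentSpace I) p₀).continuousLinearMapAt ℝ p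

variable (I) in
/-- The tangent vector at `p` with given components in the preferred chart at `p₀` (zero if
`p` is not in the domain of that chart). -/
def ofCoord (p₀ p : N) : F →L[ℝ] TangentSpace I p :=
  (trivializationAt F (TangentSpace I) p₀).symmL ℝ p

/-- The components of the vector field `X` in the preferred chart at `p₀`, as a function on the
model space. -/
def coordField (p₀ : N) (X : VecField I N) (z : F) : F :=
  toCoord I p₀ ((extChartAt I p₀).symm z) (X ((extChartAt I p₀).symm z))

/-- The components of the endomorphism field `J` in the preferred chart at `p₀`, as a function on
the model space. -/
def coordEnd (p₀ : N) (J : EndField I N) (z : F) : F →L[ℝ] F :=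
  (toCoord I p₀ ((extChartAt I p₀).symm z)).comp
    ((J ((extChartAt I p₀).symm z)).comp (ofCoord I p₀ ((extChartAt I p₀).symm z)))

variable (I) in
/-- The local vector field with constant components `a` in the preferred chart at `p₀`. -/
def coordConst (p₀ : N) (a : F) : VecField I N := fun p ↦ ofCoord I p₀ p a

variable {p₀ p : N}

theorem ofCoord_toCoord (hp : p ∈ (extChartAt I p₀).source) (v : TangentSpace I p) :
    ofCoord I p₀ p (toCoord I p₀ p v) = v :=
  (trivializationAt F (TangentSpace I) p₀).symmL_continuousLinearMapAt
    (by simpa using hp) v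

theorem toCoord_ofCoord (hp : p ∈ (extChartAt I p₀).source) (a : F) :
    toCoord I p₀ p (ofCoord I p₀ p a) = a :=
  (trivializationAt F (TangentSpace I) p₀).continuousLinearMapAt_symmL
    (by simpa using hp) a

theorem toCoord_eq_mfderiv (hp : p ∈ (extChartAt I p₀).source) :
    toCoord I p₀ p = mfderiv I 𝓘(ℝ, F) (extChartAt I p₀) p :=
  TangentBundle.continuousLinearMapAt_trivializationAt (by simpa using hp)

variable (p₀) in
/-- In the preferred chart at `p₀` itself, the components of a tangent vector at `p₀` are the vector
itself. -/
theorem toCoord_self (v : TangentSpace I p₀) : toCoord I p₀ p₀ v = v := by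
  rw [toCoord_eq_mfderiv (mem_extChartAt_source p₀), mfderiv_extChartAt_self]
  rfl

variable (p₀) in
theorem ofCoord_self (a : F) : ofCoord I p₀ p₀ a = a := by
  let v : TangentSpace I p₀ := a
  exact (congrArg (ofCoord I p₀ p₀) (toCoord_self p₀ v)).symm.trans
    (ofCoord_toCoord (mem_extChartAt_source (I := I) p₀) v)

theorem coordField_extChartAt (hp : p ∈ (extChartAt I p₀).source) (X : VecField I N) :
    coordField p₀ X (extChartAt I p₀ p) = toCoord I p₀ p (X p) := by
  rw [coordField, (extChartAt I p₀).left_inv hp]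

theorem coordEnd_extChartAt (hp : p ∈ (extChartAt I p₀).source) (J : EndField I N) (a : F) :
    coordEnd p₀ J (extChartAt I p₀ p) a = toCoord I p₀ p (J p (ofCoord I p₀ p a)) := by
  rw [coordEnd, (extChartAt I p₀).left_inv hp]
  rfl

theorem coordField_apply_end {z : F} (hz : z ∈ (extChartAt I p₀).target) (J : EndField I N)
    (X : VecField I N) :
    coordField p₀ (fun x ↦ J x (X x)) z = coordEnd p₀ J z (coordField p₀ X z) := by
  simp only [coordField, coordEnd, ContinuousLinearMap.comp_apply]
  rw [ofCoord_toCoord ((extChartAt I p₀).map_target hz)]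

theorem coordField_coordConst {z : F} (hz : z ∈ (extChartAt I p₀).target) (a : F) :
    coordField p₀ (coordConst I p₀ a) z = a :=
  toCoord_ofCoord ((extChartAt I p₀).map_target hz) a

theorem coordEnd_sq {J : EndField I N} (hJ : ∀ (x : N) (v : TangentSpace I x), J x (J x v) = -v)
    {z : F} (hz : z ∈ (extChartAt I p₀).target) (a : F) :
    coordEnd p₀ J z (coordEnd p₀ J z a) = -a := by
  simp only [coordEnd, ContinuousLinearMap.comp_apply]
  rw [ofCoord_toCoord ((extChartAt I p₀).map_target hz), hJ, map_neg,
    toCoord_ofCoord ((extChartAt I p₀).map_target hz)]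

section Boundaryless

variable [I.Boundaryless]

omit [IsManifold I ∞ N] in
theorem extChartAt_target_mem_nhds_of_mem (hp : p ∈ (extChartAt I p₀).source) :
    (extChartAt I p₀).target ∈ 𝓝 (extChartAt I p₀ p) :=
  (isOpen_extChartAt_target p₀).mem_nhds ((extChartAt I p₀).map_source hp)

omit [IsManifold I ∞ N] [I.Boundaryless] in
/-- A property holding near a point holds near its image under the chart. -/
theorem eventually_extChartAt_symm (hp : p ∈ (extChartAt I p₀).source) {P : N → Prop}
    (hP : ∀ᶠ x in 𝓝 p, P x) :
    ∀ᶠ z in 𝓝 (extChartAt I p₀ p), P ((extChartAt I p₀).symm z) := by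
  have := continuousAt_extChartAt_symm' hp
  rw [ContinuousAt, (extChartAt I p₀).left_inv hp] at this
  exact this.eventually hP

theorem contMDiffAt_comp_extChartAt_symm_iff {V : Type*} [NormedAddCommGroup V] [NormedSpace ℝ V]
    {n : ℕ∞} {f : N → V} (hp : p ∈ (extChartAt I p₀).source) :
    ContMDiffAt I 𝓘(ℝ, V) n f p ↔
      ContDiffAt ℝ n (f ∘ (extChartAt I p₀).symm) (extChartAt I p₀ p) := by
  have : IsManifold I n N := IsManifold.of_le (n := ∞) (by exact_mod_cast le_top)
  rw [contMDiffAt_iff_source_of_mem_source (x := p₀) (by simpa using hp), I.range_eq_univ,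
    contMDiffWithinAt_univ, contMDiffAt_iff_contDiffAt]

theorem mdifferentiableAt_comp_extChartAt_symm_iff {V : Type*} [NormedAddCommGroup V]
    [NormedSpace ℝ V] {f : N → V} (hp : p ∈ (extChartAt I p₀).source) :
    MDifferentiableAt I 𝓘(ℝ, V) f p ↔
      DifferentiableAt ℝ (f ∘ (extChartAt I p₀).symm) (extChartAt I p₀ p) := by
  rw [mdifferentiableAt_iff_source_of_mem_source (x := p₀) (by simpa using hp), I.range_eq_univ,
    mdifferentiableWithinAt_univ, mdifferentiableAt_iff_differentiableAt]

theorem trivializationAt_comp_symm_eventuallyEq (hp : p ∈ (extChartAt I p₀).source)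
    (X : VecField I N) :
    (fun x ↦ (trivializationAt F (TangentSpace I) p₀ ⟨x, X x⟩).2) ∘ (extChartAt I p₀).symm
      =ᶠ[𝓝 (extChartAt I p₀ p)] coordField p₀ X := by
  filter_upwards [extChartAt_target_mem_nhds_of_mem hp] with z hz
  have hz' := (extChartAt I p₀).map_target hz
  rw [extChartAt_source] at hz'
  rw [coordField, toCoord, Trivialization.continuousLinearMapAt_apply,
    Trivialization.coe_linearMapAt_of_mem _ (by simpa using hz')]
  rfl

theorem smoothVecAt_iff (hp : p ∈ (extChartAt I p₀).source) (X : VecField I N) :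
    SmoothVecAt X p ↔ ContDiffAt ℝ ∞ (coordField p₀ X) (extChartAt I p₀ p) := by
  have : IsManifold I (∞ + 1) N := ‹IsManifold I ∞ N›
  have : ContMDiffVectorBundle ∞ F (TangentSpace I : N → Type _) I :=
    TangentBundle.contMDiffVectorBundle
  rw [SmoothVecAt, Trivialization.contMDiffAt_section_iff (IB := I)
    (trivializationAt F (TangentSpace I) p₀) (by simpa using hp),
    contMDiffAt_comp_extChartAt_symm_iff (n := ⊤) hp]
  have h := trivializationAt_comp_symm_eventuallyEq hp X
  exact ⟨fun hX ↦ hX.congr_of_eventuallyEq h.symm, fun hX ↦ hX.congr_of_eventuallyEq h⟩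

theorem mdifferentiableAt_vecField_iff (hp : p ∈ (extChartAt I p₀).source) (X : VecField I N) :
    MDifferentiableAt I I.tangent (fun x ↦ (⟨x, X x⟩ : TangentBundle I N)) p ↔
      DifferentiableAt ℝ (coordField p₀ X) (extChartAt I p₀ p) := by
  rw [Trivialization.mdifferentiableAt_section_iff I
    (trivializationAt F (TangentSpace I) p₀) _ (by simpa using hp),
    mdifferentiableAt_comp_extChartAt_symm_iff hp]
  exact (trivializationAt_comp_symm_eventuallyEq hp X).differentiableAt_iff

omit [I.Boundaryless] in
theorem SmoothVecAt.mdifferentiableAt {X : VecField I N} (hX : SmoothVecAt X p) :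
    MDifferentiableAt I I.tangent (fun x ↦ (⟨x, X x⟩ : TangentBundle I N)) p :=
  ContMDiffAt.mdifferentiableAt hX (by simp)

omit [I.Boundaryless] in
theorem SmoothVecAt.eventually_mdifferentiableAt {X : VecField I N} (hX : SmoothVecAt X p) :
    ∀ᶠ x in 𝓝 p,
      MDifferentiableAt I I.tangent (fun x ↦ (⟨x, X x⟩ : TangentBundle I N)) x := by
  have h1 : ContMDiffAt I I.tangent 1 (fun x ↦ (⟨x, X x⟩ : TangentBundle I N)) p :=
    ContMDiffAt.of_le hX (by simp)
  exact ((contMDiffAt_iff_contMDiffAt_nhds (by simp)).1 h1).mono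
    fun x hx ↦ hx.mdifferentiableAt one_ne_zero

theorem smoothVecAt_coordConst (hp : p ∈ (extChartAt I p₀).source) (a : F) :
    SmoothVecAt (coordConst I p₀ a) p := by
  rw [smoothVecAt_iff hp]
  refine contDiffAt_const (c := a) |>.congr_of_eventuallyEq ?_
  filter_upwards [extChartAt_target_mem_nhds_of_mem hp] with z hz
  exact coordField_coordConst hz a

/-- Smoothness of an endomorphism field as a section is smoothness of its components. -/
theorem contMDiffAt_endField_iff (p₀ : N) (J : EndField I N) :
    ContMDiffAt I (I.prod 𝓘(ℝ, F →L[ℝ] F)) ∞ (fun x ↦ TotalSpace.mk' (F →L[ℝ] F)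
      (E := fun x : N ↦ TangentSpace I x →L[ℝ] TangentSpace I x) x (J x)) p₀ ↔
      ContDiffAt ℝ ∞ (coordEnd p₀ J) (extChartAt I p₀ p₀) := by
  rw [contMDiffAt_hom_bundle]
  refine (and_iff_right contMDiffAt_id).trans ?_
  rw [contMDiffAt_comp_extChartAt_symm_iff (n := ⊤) (mem_extChartAt_source p₀)]
  rfl

variable [CompleteSpace F]

omit [CompleteSpace F] in
theorem mlieBracket_eq_lieBracket (V W : ∀ x : F, TangentSpace 𝓘(ℝ, F) x) (x : F) :
    VectorField.mlieBracket 𝓘(ℝ, F) V W x = VectorField.lieBracket ℝ V W x := by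
  rw [← VectorField.mlieBracketWithin_univ, VectorField.mlieBracketWithin_eq_lieBracketWithin]
  exact congrFun VectorField.lieBracketWithin_univ x

/-- The Lie bracket is computed in any chart. -/
theorem toCoord_mlieBracket (hp : p ∈ (extChartAt I p₀).source) {X Y : VecField I N}
    (hX : MDifferentiableAt I I.tangent (fun x ↦ (⟨x, X x⟩ : TangentBundle I N)) p)
    (hY : MDifferentiableAt I I.tangent (fun x ↦ (⟨x, Y x⟩ : TangentBundle I N)) p) :
    toCoord I p₀ p (VectorField.mlieBracket I X Y p) =
      VectorField.lieBracket ℝ (coordField p₀ X) (coordField p₀ Y) (extChartAt I p₀ p) := by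
  set φ := extChartAt I p₀ with hφ
  have hpb : ∀ (V : VecField I N), ∀ z ∈ φ.target,
      VectorField.mpullback 𝓘(ℝ, F) I φ.symm V z = coordField p₀ V z := by
    intro V z hz
    have h1 := mfderiv_extChartAt_comp_mfderivWithin_extChartAt_symm hz
    have h2 := mfderivWithin_extChartAt_symm_comp_mfderiv_extChartAt hz
    rw [I.range_eq_univ, mfderivWithin_univ] at h1 h2
    rw [VectorField.mpullback_apply, ContinuousLinearMap.inverse_eq h2 h1, coordField,
      toCoord_eq_mfderiv (φ.map_target hz)]
    rfl
  have hz := φ.map_source hp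
  have hl : φ.symm (φ p) = p := φ.left_inv hp
  have hev : ∀ (V : VecField I N), VectorField.mpullback 𝓘(ℝ, F) I φ.symm V =ᶠ[𝓝 (φ p)]
      coordField p₀ V := fun V ↦
    Filter.eventuallyEq_of_mem (extChartAt_target_mem_nhds_of_mem hp) (hpb V)
  have : IsManifold I (minSmoothness ℝ 2) N := by simpa using
    (inferInstance : IsManifold I 2 N)
  have hsymm : ContMDiffAt 𝓘(ℝ, F) I ∞ φ.symm (φ p) :=
    (contMDiffOn_extChartAt_symm p₀).contMDiffAt (extChartAt_target_mem_nhds_of_mem hp)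
  have h := VectorField.mpullback_mlieBracket (I := 𝓘(ℝ, F)) (I' := I) (n := ∞) (f := φ.symm)
    (x₀ := φ p) (V := X) (W := Y) (by rwa [hl]) (by rwa [hl]) hsymm
    (by simpa using (WithTop.coe_le_coe.2 le_top : ((2 : ℕ∞) : WithTop ℕ∞) ≤ ∞))
  rw [hpb _ _ hz, coordField_extChartAt hp] at h
  exact (h.trans ((hev X).mlieBracket_vectorField_eq (hev Y))).trans
    (mlieBracket_eq_lieBracket _ _ _)

/-- In the preferred chart at `p`, the Nijenhuis tensor of an almost complex structure has the
pointwise expression `localNijenhuis`. -/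
theorem nijenhuis_eq {J : EndField I N} (hJ : IsAlmostComplex J) {X Y : VecField I N} (p : N)
    (hX : SmoothVecAt X p) (hY : SmoothVecAt Y p) :
    nijenhuis J X Y p = localNijenhuis (coordEnd p J) (extChartAt I p p) (X p) (Y p) := by
  have hp := mem_extChartAt_source (I := I) p
  have hz := mem_extChartAt_target (I := I) p
  have hA : DifferentiableAt ℝ (coordEnd p J) (extChartAt I p p) :=
    ((contMDiffAt_endField_iff p J).1 (hJ.smooth p)).differentiableAt (by simp)
  have hev : ∀ X : VecField I N, coordField p (fun x ↦ J x (X x)) =ᶠ[𝓝 (extChartAt I p p)]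
      fun z ↦ coordEnd p J z (coordField p X z) := fun X ↦
    Filter.eventuallyEq_of_mem (extChartAt_target_mem_nhds_of_mem hp)
      fun z hz ↦ coordField_apply_end hz J X
  have hX' := hX.mdifferentiableAt
  have hY' := hY.mdifferentiableAt
  have hcX := (mdifferentiableAt_vecField_iff hp X).1 hX'
  have hcY := (mdifferentiableAt_vecField_iff hp Y).1 hY'
  have hJd : ∀ X : VecField I N, DifferentiableAt ℝ (coordField p X) (extChartAt I p p) →
      MDifferentiableAt I I.tangent (fun x ↦ (⟨x, J x (X x)⟩ : TangentBundle I N)) p := by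
    intro X hX
    rw [mdifferentiableAt_vecField_iff hp (fun x ↦ J x (X x)), (hev X).differentiableAt_iff]
    exact hA.clm_apply hX
  have hJX := hJd X hcX
  have hJY := hJd Y hcY
  have hJp : ∀ v : TangentSpace I p, toCoord I p p (J p v) =
      coordEnd p J (extChartAt I p p) (toCoord I p p v) := by
    intro v
    rw [coordEnd_extChartAt hp, ofCoord_toCoord hp]
  have key : toCoord I p p (nijenhuis J X Y p) =
      localNijenhuis (coordEnd p J) (extChartAt I p p) (X p) (Y p) := by
    rw [nijenhuis, map_sub, map_add, map_add, hJp, hJp, toCoord_mlieBracket hp hX' hY',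
      toCoord_mlieBracket hp hJX hY', toCoord_mlieBracket hp hX' hJY,
      toCoord_mlieBracket hp hJX hJY]
    have := lieBracket_nijenhuis_eq hA (coordEnd_sq hJ.sq hz) hcX hcY
    rw [coordField_extChartAt hp, coordField_extChartAt hp, toCoord_self, toCoord_self] at this
    rw [← this, (hev X).lieBracket_vectorField_eq (EventuallyEq.refl _ (coordField p Y)),
      (EventuallyEq.refl _ (coordField p X)).lieBracket_vectorField_eq (hev Y),
      (hev X).lieBracket_vectorField_eq (hev Y)]
  rwa [toCoord_self] at key

/-- Integrability is the vanishing of the pointwise Nijenhuis expression at the centre of every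
preferred chart. -/
theorem isIntegrableComplex_iff {J : EndField I N} (hJ : IsAlmostComplex J) :
    IsIntegrableComplex J ↔
      ∀ (p : N) (x y : F), localNijenhuis (coordEnd p J) (extChartAt I p p) x y = 0 := by
  constructor
  · rintro ⟨-, h⟩ p x y
    have hp := mem_extChartAt_source (I := I) p
    have hx := smoothVecAt_coordConst hp x
    have hy := smoothVecAt_coordConst hp y
    have := h p _ _ hx hy
    rwa [nijenhuis_eq hJ p hx hy, coordConst, coordConst, ofCoord_self, ofCoord_self] at this
  · intro h
    refine ⟨hJ, fun p X Y hX hY ↦ ?_⟩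
    rw [nijenhuis_eq hJ p hX hY]
    exact h p _ _

end Boundaryless

end Coordinates

/-! ### The connection in a chart of the base -/

/-- On a finite-dimensional space, pointwise smooth families of linear maps are smooth. -/
theorem contDiffAt_clm_of_apply {D E F : Type*} [NormedAddCommGroup D] [NormedSpace ℝ D]
    [NormedAddCommGroup E] [NormedSpace ℝ E] [FiniteDimensional ℝ E] [NormedAddCommGroup F]
    [NormedSpace ℝ F] {n : WithTop ℕ∞} {f : D → E →L[ℝ] F} {x : D}
    (h : ∀ y, ContDiffAt ℝ n (fun z ↦ f z y) x) : ContDiffAt ℝ n f x := by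
  let b := Module.finBasis ℝ E
  have : f = fun z ↦ ∑ i, (LinearMap.toContinuousLinearMap (b.coord i)).smulRight (f z (b i)) := by
    ext z y
    conv_lhs => rw [← b.sum_repr y, map_sum]
    simp [sum_apply]
  rw [this]
  exact ContDiffAt.sum fun i _ ↦ contDiffAt_const.smulRight (h _)

section Base

variable {E : Type*} [NormedAddCommGroup E] [NormedSpace ℝ E] [FiniteDimensional ℝ E]
  {M : Type*} [TopologicalSpace M] [ChartedSpace E M] [IsManifold 𝓘(ℝ, E) ∞ M]

/-- The connection coefficients in the preferred chart at `p₀`: the value `coordChristoffel D p₀ z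
y a` is `yⁱ Γᵏᵢⱼ aʲ`, that is, the derivative `∇_a` of the field with constant components `y`. It
is assembled from the values on a basis, so as to be linear in `y` at every `z`. -/
def coordChristoffel (D : AffineConnection E M) (p₀ : M) (z : E) : E →L[ℝ] E →L[ℝ] E :=
  ∑ i, (LinearMap.toContinuousLinearMap ((Module.finBasis ℝ E).coord i)).smulRight
    (coordEnd p₀ (fun x ↦ D (coordConst 𝓘(ℝ, E) p₀ (Module.finBasis ℝ E i)) x) z)

variable {D : AffineConnection E M} {p₀ p : M}

theorem coordChristoffel_apply (z y : E) : coordChristoffel D p₀ z y =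
    ∑ i, (Module.finBasis ℝ E).coord i y •
      coordEnd p₀ (fun x ↦ D (coordConst 𝓘(ℝ, E) p₀ (Module.finBasis ℝ E i)) x) z := by
  simp [coordChristoffel, sum_apply]

omit [FiniteDimensional ℝ E] in
theorem mdifferentiableAt_coordConst (hp : p ∈ (extChartAt 𝓘(ℝ, E) p₀).source) (a : E) :
    MDifferentiableAt 𝓘(ℝ, E) 𝓘(ℝ, E).tangent
      (fun x ↦ (⟨x, coordConst 𝓘(ℝ, E) p₀ a x⟩ : TangentBundle 𝓘(ℝ, E) M)) p :=
  (smoothVecAt_coordConst hp a).mdifferentiableAt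

omit [FiniteDimensional ℝ E] in
/-- The differential of a function, in a chart. -/
theorem mvfderiv_eq_fderiv {V : Type*} [NormedAddCommGroup V] [NormedSpace ℝ V] {f : M → V}
    (hp : p ∈ (extChartAt 𝓘(ℝ, E) p₀).source) (hf : MDifferentiableAt 𝓘(ℝ, E) 𝓘(ℝ, V) f p)
    (v : TangentSpace 𝓘(ℝ, E) p) :
    mvfderiv 𝓘(ℝ, E) f p v =
      fderiv ℝ (f ∘ (extChartAt 𝓘(ℝ, E) p₀).symm) (extChartAt 𝓘(ℝ, E) p₀ p)
        (toCoord 𝓘(ℝ, E) p₀ p v) := by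
  have h1 := ((mdifferentiableAt_comp_extChartAt_symm_iff hp).1 hf).hasFDerivAt.hasMFDerivAt
  have hs : p ∈ (chartAt E p₀).source := by simpa using hp
  have h2 := h1.comp p (mdifferentiableAt_extChartAt hs).hasMFDerivAt
  have h3 : HasMFDerivAt 𝓘(ℝ, E) 𝓘(ℝ, V) f p _ := h2.congr_of_eventuallyEq (by
    filter_upwards [extChartAt_source_mem_nhds' hp] with x hx
    change f x = f ((extChartAt 𝓘(ℝ, E) p₀).symm (extChartAt 𝓘(ℝ, E) p₀ x))
    rw [(extChartAt 𝓘(ℝ, E) p₀).left_inv hx])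
  rw [mvfderiv, h3.mfderiv, toCoord_eq_mfderiv hp]
  rfl

omit [FiniteDimensional ℝ E] in
theorem AffineConnection.map_sum_smul {ι : Type*} (s : Finset ι) {f : ι → M → ℝ}
    {X : ι → VecField 𝓘(ℝ, E) M} (hf : ∀ i, MDifferentiableAt 𝓘(ℝ, E) 𝓘(ℝ) (f i) p)
    (hX : ∀ i, MDifferentiableAt 𝓘(ℝ, E) 𝓘(ℝ, E).tangent
      (fun x ↦ (⟨x, X i x⟩ : TangentBundle 𝓘(ℝ, E) M)) p) (v : TangentSpace 𝓘(ℝ, E) p) :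
    D (fun x ↦ ∑ i ∈ s, f i x • X i x) p v =
      ∑ i ∈ s, (f i p • D (X i) p v + mvfderiv 𝓘(ℝ, E) (f i) p v • X i p) := by
  classical
  induction s using Finset.induction_on with
  | empty =>
    have : D (fun _ ↦ 0) = 0 := D.zero
    simp only [Finset.sum_empty, this]
    rfl
  | insert i s hi ih =>
    have h1 : (fun x ↦ ∑ j ∈ insert i s, f j x • X j x) =
        (f i • X i) + fun x ↦ ∑ j ∈ s, f j x • X j x := by
      funext x
      rw [Finset.sum_insert hi]
      rfl
    rw [h1, D.isCovariantDerivativeOnUniv.add (MDifferentiableAt.smul_section (hf i) (hX i))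
      (MDifferentiableAt.sum_section (t := fun j x ↦ f j x • X j x) fun j _ ↦
        MDifferentiableAt.smul_section (hf j) (hX j)),
      D.isCovariantDerivativeOnUniv.leibniz (hX i) (hf i), Finset.sum_insert hi, ← ih]
    rfl

/-- The covariant derivative in a chart: `∇_a X = dX(a) + Γ(X, a)`. -/
theorem toCoord_covDeriv (hp : p ∈ (extChartAt 𝓘(ℝ, E) p₀).source) {X : VecField 𝓘(ℝ, E) M}
    (hX : MDifferentiableAt 𝓘(ℝ, E) 𝓘(ℝ, E).tangent
      (fun x ↦ (⟨x, X x⟩ : TangentBundle 𝓘(ℝ, E) M)) p)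
    (v : TangentSpace 𝓘(ℝ, E) p) :
    toCoord 𝓘(ℝ, E) p₀ p (D X p v) =
      fderiv ℝ (coordField p₀ X) (extChartAt 𝓘(ℝ, E) p₀ p) (toCoord 𝓘(ℝ, E) p₀ p v)
        + coordChristoffel D p₀ (extChartAt 𝓘(ℝ, E) p₀ p) (toCoord 𝓘(ℝ, E) p₀ p (X p))
          (toCoord 𝓘(ℝ, E) p₀ p v) := by
  let b := Module.finBasis ℝ E
  let L : Fin (Module.finrank ℝ E) → E →L[ℝ] ℝ := fun i ↦
    LinearMap.toContinuousLinearMap (b.coord i)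
  let f : Fin (Module.finrank ℝ E) → M → ℝ := fun i x ↦ L i (toCoord 𝓘(ℝ, E) p₀ x (X x))
  have hXd := (mdifferentiableAt_vecField_iff hp X).1 hX
  have hf : ∀ i, MDifferentiableAt 𝓘(ℝ, E) 𝓘(ℝ) (f i) p := fun i ↦
    (mdifferentiableAt_comp_extChartAt_symm_iff hp).2
      ((L i).differentiableAt.comp (extChartAt 𝓘(ℝ, E) p₀ p) hXd)
  have hfd : ∀ i, mvfderiv 𝓘(ℝ, E) (f i) p v =
      L i (fderiv ℝ (coordField p₀ X) (extChartAt 𝓘(ℝ, E) p₀ p) (toCoord 𝓘(ℝ, E) p₀ p v)) := by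
    intro i
    have h := ((L i).hasFDerivAt.comp (extChartAt 𝓘(ℝ, E) p₀ p) hXd.hasFDerivAt).fderiv
    rw [mvfderiv_eq_fderiv hp (hf i) v]
    exact congrArg (fun A : E →L[ℝ] ℝ ↦ A (toCoord 𝓘(ℝ, E) p₀ p v)) h
  have hL : ∀ a : E, ∑ i, L i a • b i = a := fun a ↦ b.sum_repr a
  -- Near `p`, expand `X` in the coordinate fields and use the Leibniz rule.
  have hsum : ∀ᶠ x in 𝓝 p, X x = ∑ i, f i x • coordConst 𝓘(ℝ, E) p₀ (b i) x := by
    filter_upwards [extChartAt_source_mem_nhds' hp] with x hx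
    conv_lhs => rw [← ofCoord_toCoord hx (X x), ← hL (toCoord 𝓘(ℝ, E) p₀ x (X x)), map_sum]
    simp only [map_smul]
    rfl
  have hc := fun i ↦ mdifferentiableAt_coordConst hp (b i)
  have hXs : MDifferentiableAt 𝓘(ℝ, E) 𝓘(ℝ, E).tangent (fun x ↦ (⟨x, ∑ i, f i x •
      coordConst 𝓘(ℝ, E) p₀ (b i) x⟩ : TangentBundle 𝓘(ℝ, E) M)) p :=
    MDifferentiableAt.sum_section (t := fun j x ↦ f j x • coordConst 𝓘(ℝ, E) p₀ (b j) x) fun j _ ↦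
        MDifferentiableAt.smul_section (hf j) (hc j)
  rw [D.isCovariantDerivativeOnUniv.congr_of_eventuallyEq hX hXs univ_mem hsum,
    AffineConnection.map_sum_smul Finset.univ hf hc, map_sum]
  simp only [map_add, map_smul, Finset.sum_add_distrib, hfd]
  rw [add_comm]
  congr 1
  · simp only [coordConst, toCoord_ofCoord hp]
    exact hL _
  · rw [coordChristoffel_apply, sum_apply]
    refine Finset.sum_congr rfl fun i _ ↦ ?_
    rw [smul_apply, coordEnd_extChartAt hp, ofCoord_toCoord hp]
    rfl

/-- The defining property of the coefficients, now for all constant fields and not only for those of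
the basis. -/
theorem coordChristoffel_eq (hp : p ∈ (extChartAt 𝓘(ℝ, E) p₀).source) (y a : E) :
    coordChristoffel D p₀ (extChartAt 𝓘(ℝ, E) p₀ p) y a =
      toCoord 𝓘(ℝ, E) p₀ p (D (coordConst 𝓘(ℝ, E) p₀ y) p (ofCoord 𝓘(ℝ, E) p₀ p a)) := by
  rw [toCoord_covDeriv hp (mdifferentiableAt_coordConst hp y), coordConst, toCoord_ofCoord hp,
    toCoord_ofCoord hp]
  have : coordField p₀ (coordConst 𝓘(ℝ, E) p₀ y) =ᶠ[𝓝 (extChartAt 𝓘(ℝ, E) p₀ p)] fun _ ↦ y :=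
    Filter.eventuallyEq_of_mem (extChartAt_target_mem_nhds_of_mem hp)
      fun z hz ↦ coordField_coordConst hz y
  rw [this.fderiv_eq]
  simp

/-- Smooth connections have smooth coefficients. Smoothness of `∇` is a statement about global
fields, so that a coordinate field is first cut off by a bump function. -/
theorem contDiffAt_coordChristoffel [T2Space M]
    (hD : CovariantDerivative.ContMDiffCovariantDerivative D ∞) (p₀ : M) :
    ContDiffAt ℝ ∞ (coordChristoffel D p₀) (extChartAt 𝓘(ℝ, E) p₀ p₀) := by
  refine contDiffAt_clm_of_apply fun y ↦ ?_
  have hp := mem_extChartAt_source (I := 𝓘(ℝ, E)) p₀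
  have key : ∀ y : E, ContDiffAt ℝ ∞ (coordEnd p₀ (fun x ↦ D (coordConst 𝓘(ℝ, E) p₀ y) x))
      (extChartAt 𝓘(ℝ, E) p₀ p₀) := by
    intro y
    rw [← contMDiffAt_endField_iff]
    obtain ⟨ψ⟩ : Nonempty (SmoothBumpFunction 𝓘(ℝ, E) p₀) := inferInstance
    have hs : ContMDiff 𝓘(ℝ, E) 𝓘(ℝ, E).tangent ∞
        (fun x ↦ (⟨x, ((ψ : M → ℝ) • coordConst 𝓘(ℝ, E) p₀ y) x⟩ : TangentBundle 𝓘(ℝ, E) M)) := by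
      refine ContMDiffOn.smul_section_of_tsupport (u := (extChartAt 𝓘(ℝ, E) p₀).source)
        ψ.contMDiff.contMDiffOn (isOpen_extChartAt_source p₀) ψ.tsupport_subset_extChartAt_source ?_
      exact fun x hx ↦ (smoothVecAt_coordConst hx y).contMDiffWithinAt
    have h := (hD.contMDiff.contMDiff hs.contMDiffOn).contMDiffAt (x := p₀) univ_mem
    refine h.congr_of_eventuallyEq ?_
    filter_upwards [ψ.eventuallyEq_one.eventuallyEq_nhds,
      extChartAt_source_mem_nhds (I := 𝓘(ℝ, E)) p₀]
      with x hx hx'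
    have : D (coordConst 𝓘(ℝ, E) p₀ y) x = D ((ψ : M → ℝ) • coordConst 𝓘(ℝ, E) p₀ y) x := by
      refine D.isCovariantDerivativeOnUniv.congr_of_eventuallyEq
        (mdifferentiableAt_coordConst hx' y) (hs.mdifferentiable (by simp) x) univ_mem ?_
      filter_upwards [hx] with x' hx'
      simp [hx']
    simp only [this]
  simp only [coordChristoffel_apply]
  exact ContDiffAt.sum fun i _ ↦ (key _).const_smul _

omit [FiniteDimensional ℝ E] [IsManifold 𝓘(ℝ, E) ∞ M] in
theorem eventually_of_forall_mem_source {P : E → Prop} (p₀ : M)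
    (h : ∀ p ∈ (extChartAt 𝓘(ℝ, E) p₀).source, P (extChartAt 𝓘(ℝ, E) p₀ p)) :
    ∀ᶠ z in 𝓝 (extChartAt 𝓘(ℝ, E) p₀ p₀), P z := by
  filter_upwards [extChartAt_target_mem_nhds (I := 𝓘(ℝ, E)) p₀] with z hz
  rw [← (extChartAt 𝓘(ℝ, E) p₀).right_inv hz]
  exact h _ ((extChartAt 𝓘(ℝ, E) p₀).map_target hz)

/-- A torsion-free connection has symmetric coefficients. -/
theorem coordChristoffel_symm (hT : IsTorsionFree D) (p₀ : M) :
    ∀ᶠ z in 𝓝 (extChartAt 𝓘(ℝ, E) p₀ p₀), ∀ a b,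
      coordChristoffel D p₀ z a b = coordChristoffel D p₀ z b a := by
  have : CompleteSpace E := FiniteDimensional.complete ℝ E
  refine eventually_of_forall_mem_source p₀ fun p hp a b ↦ ?_
  have h := hT p (coordConst 𝓘(ℝ, E) p₀ b) (coordConst 𝓘(ℝ, E) p₀ a) (smoothVecAt_coordConst hp b)
    (smoothVecAt_coordConst hp a)
  have h' := congrArg (toCoord 𝓘(ℝ, E) p₀ p) h
  rw [map_sub, toCoord_mlieBracket hp (mdifferentiableAt_coordConst hp b)
    (mdifferentiableAt_coordConst hp a)] at h'
  have hc : ∀ a, coordField p₀ (coordConst 𝓘(ℝ, E) p₀ a) =ᶠ[𝓝 (extChartAt 𝓘(ℝ, E) p₀ p)]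
      fun _ ↦ a :=
    fun a ↦ Filter.eventuallyEq_of_mem (extChartAt_target_mem_nhds_of_mem hp)
      fun z hz ↦ coordField_coordConst hz a
  rw [(hc b).lieBracket_vectorField_eq (hc a)] at h'
  rw [coordChristoffel_eq hp, coordChristoffel_eq hp, ← sub_eq_zero]
  refine h'.trans ?_
  simp [VectorField.lieBracket]

/-- The covariant derivative of an endomorphism field in a chart. -/
theorem toCoord_covDeriv_end {J : EndField 𝓘(ℝ, E) M} (hp : p ∈ (extChartAt 𝓘(ℝ, E) p₀).source)
    (hJ : DifferentiableAt ℝ (coordEnd p₀ J) (extChartAt 𝓘(ℝ, E) p₀ p)) {Y : VecField 𝓘(ℝ, E) M}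
    (hY : MDifferentiableAt 𝓘(ℝ, E) 𝓘(ℝ, E).tangent
      (fun x ↦ (⟨x, Y x⟩ : TangentBundle 𝓘(ℝ, E) M)) p)
    (v : TangentSpace 𝓘(ℝ, E) p) :
    toCoord 𝓘(ℝ, E) p₀ p (D (fun x ↦ J x (Y x)) p v - J p (D Y p v)) =
      localNabla (coordChristoffel D p₀) (coordEnd p₀ J) (extChartAt 𝓘(ℝ, E) p₀ p)
        (toCoord 𝓘(ℝ, E) p₀ p v) (toCoord 𝓘(ℝ, E) p₀ p (Y p)) := by
  have hev : coordField p₀ (fun x ↦ J x (Y x)) =ᶠ[𝓝 (extChartAt 𝓘(ℝ, E) p₀ p)]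
      fun z ↦ coordEnd p₀ J z (coordField p₀ Y z) :=
    Filter.eventuallyEq_of_mem (extChartAt_target_mem_nhds_of_mem hp)
      fun z hz ↦ coordField_apply_end hz J Y
  have hYd := (mdifferentiableAt_vecField_iff hp Y).1 hY
  have hJY : MDifferentiableAt 𝓘(ℝ, E) 𝓘(ℝ, E).tangent
      (fun x ↦ (⟨x, J x (Y x)⟩ : TangentBundle 𝓘(ℝ, E) M)) p := by
    rw [mdifferentiableAt_vecField_iff hp (fun x ↦ J x (Y x)), hev.differentiableAt_iff]
    exact hJ.clm_apply hYd
  have hJp : ∀ w : TangentSpace 𝓘(ℝ, E) p, toCoord 𝓘(ℝ, E) p₀ p (J p w) =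
      coordEnd p₀ J (extChartAt 𝓘(ℝ, E) p₀ p) (toCoord 𝓘(ℝ, E) p₀ p w) := by
    intro w
    rw [coordEnd_extChartAt hp, ofCoord_toCoord hp]
  rw [map_sub, hJp, toCoord_covDeriv hp hJY, toCoord_covDeriv hp hY, hJp, hev.fderiv_eq,
    (hJ.hasFDerivAt.clm_apply hYd.hasFDerivAt).fderiv, localNabla]
  simp only [add_apply, ContinuousLinearMap.comp_apply, ContinuousLinearMap.flip_apply,
    coordField_extChartAt hp, map_add]
  abel

theorem isParallel_of_localNabla {J : EndField 𝓘(ℝ, E) M} (hJ : IsAlmostComplex J)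
    (h : ∀ (p : M) (a c : E), localNabla (coordChristoffel D p) (coordEnd p J)
      (extChartAt 𝓘(ℝ, E) p p) a c = 0) : IsParallel D J := by
  intro p Y v hY
  have hp := mem_extChartAt_source (I := 𝓘(ℝ, E)) p
  have hJp := ((contMDiffAt_endField_iff p J).1 (hJ.smooth p)).differentiableAt (by simp)
  have := toCoord_covDeriv_end (D := D) hp hJp hY.mdifferentiableAt v
  rw [h, toCoord_self] at this
  exact sub_eq_zero.1 this

theorem IsParallel.localNabla_eq_zero {J : EndField 𝓘(ℝ, E) M} (hJ : IsAlmostComplex J)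
    (h : IsParallel D J) (p₀ : M) :
    ∀ᶠ z in 𝓝 (extChartAt 𝓘(ℝ, E) p₀ p₀), ∀ a c,
      localNabla (coordChristoffel D p₀) (coordEnd p₀ J) z a c = 0 := by
  have hJ1 : ContDiffAt ℝ 1 (coordEnd p₀ J) (extChartAt 𝓘(ℝ, E) p₀ p₀) :=
    ((contMDiffAt_endField_iff p₀ J).1 (hJ.smooth p₀)).of_le (by simp)
  have hev : ∀ᶠ z in 𝓝 (extChartAt 𝓘(ℝ, E) p₀ p₀), DifferentiableAt ℝ (coordEnd p₀ J) z →
      ∀ a c, localNabla (coordChristoffel D p₀) (coordEnd p₀ J) z a c = 0 := by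
    refine eventually_of_forall_mem_source p₀ fun p hp hd a c ↦ ?_
    have := toCoord_covDeriv_end (D := D) hp hd (mdifferentiableAt_coordConst hp c)
      (ofCoord 𝓘(ℝ, E) p₀ p a)
    rw [h p _ _ (smoothVecAt_coordConst hp c), sub_self, map_zero, toCoord_ofCoord hp, coordConst,
      toCoord_ofCoord hp] at this
    exact this.symm
  filter_upwards [hev, hJ1.eventually (by simp)] with z hz hd
  exact hz (hd.differentiableAt one_ne_zero)

/-- The curvature in the preferred chart at `p`. -/
theorem curvature_eq [T2Space M] (hD : CovariantDerivative.ContMDiffCovariantDerivative D ∞) (p : M)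
    {X Y Z : VecField 𝓘(ℝ, E) M} (hX : SmoothVecAt X p) (hY : SmoothVecAt Y p)
    (hZ : SmoothVecAt Z p) :
    curvature D X Y Z p =
      localCurvature (coordChristoffel D p) (extChartAt 𝓘(ℝ, E) p p) (X p) (Y p) (Z p) := by
  have : CompleteSpace E := FiniteDimensional.complete ℝ E
  set z := extChartAt 𝓘(ℝ, E) p p with hz
  set G := coordChristoffel D p with hG
  have hp := mem_extChartAt_source (I := 𝓘(ℝ, E)) p
  have hGd : HasFDerivAt G _ z :=
    ((contDiffAt_coordChristoffel hD p).differentiableAt (by simp)).hasFDerivAt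
  have hfield : ∀ W : VecField 𝓘(ℝ, E) M, toCoord 𝓘(ℝ, E) p p (W p) = coordField p W z :=
    fun W ↦ (coordField_extChartAt hp W).symm
  have hZ2 : ContDiffAt ℝ 2 (coordField p Z) z := ((smoothVecAt_iff hp Z).1 hZ).of_le
    (by simpa using (WithTop.coe_le_coe.2 le_top : ((2 : ℕ∞) : WithTop ℕ∞) ≤ ∞))
  have hZd : HasFDerivAt (coordField p Z) _ z := (hZ2.differentiableAt two_ne_zero).hasFDerivAt
  have hZdd : HasFDerivAt (fderiv ℝ (coordField p Z)) _ z :=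
    ((hZ2.fderiv_right (m := 1) (by norm_num)).differentiableAt one_ne_zero).hasFDerivAt
  have hsymm : IsSymmSndFDerivAt ℝ (coordField p Z) z := hZ2.isSymmSndFDerivAt (by simp)
  -- The iterated derivative `∇_X ∇_Y Z` in the chart.
  have second : ∀ (X Y : VecField 𝓘(ℝ, E) M), SmoothVecAt X p → SmoothVecAt Y p →
      toCoord 𝓘(ℝ, E) p p (D (fun x ↦ D Z x (Y x)) p (X p)) =
        fderiv ℝ (fderiv ℝ (coordField p Z)) z (coordField p X z) (coordField p Y z)
        + fderiv ℝ (coordField p Z) z (fderiv ℝ (coordField p Y) z (coordField p X z))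
        + fderiv ℝ G z (coordField p X z) (coordField p Z z) (coordField p Y z)
        + G z (fderiv ℝ (coordField p Z) z (coordField p X z)) (coordField p Y z)
        + G z (coordField p Z z) (fderiv ℝ (coordField p Y) z (coordField p X z))
        + G z (fderiv ℝ (coordField p Z) z (coordField p Y z)
            + G z (coordField p Z z) (coordField p Y z)) (coordField p X z) := by
    intro X Y hX hY
    have hYd : HasFDerivAt (coordField p Y) _ z :=
      (((smoothVecAt_iff hp Y).1 hY).differentiableAt (by simp)).hasFDerivAt
    have hev : coordField p (fun x ↦ D Z x (Y x)) =ᶠ[𝓝 z] fun w ↦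
        fderiv ℝ (coordField p Z) w (coordField p Y w) + G w (coordField p Z w)
          (coordField p Y w) := by
      filter_upwards [eventually_extChartAt_symm hp hZ.eventually_mdifferentiableAt,
        extChartAt_target_mem_nhds (I := 𝓘(ℝ, E)) p] with w hw hwt
      have := toCoord_covDeriv (D := D) ((extChartAt 𝓘(ℝ, E) p).map_target hwt) hw
        (Y ((extChartAt 𝓘(ℝ, E) p).symm w))
      rw [(extChartAt 𝓘(ℝ, E) p).right_inv hwt] at this
      exact this
    have hder := ((hZdd.clm_apply hYd).add ((hGd.clm_apply hZd).clm_apply hYd))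
    have hW : MDifferentiableAt 𝓘(ℝ, E) 𝓘(ℝ, E).tangent
        (fun x ↦ (⟨x, D Z x (Y x)⟩ : TangentBundle 𝓘(ℝ, E) M)) p := by
      rw [mdifferentiableAt_vecField_iff hp (fun x ↦ D Z x (Y x)), hev.differentiableAt_iff]
      exact hder.differentiableAt
    rw [toCoord_covDeriv hp hW, hev.fderiv_eq, ← coordField_extChartAt hp (fun x ↦ D Z x (Y x)),
      hev.self_of_nhds]
    have hder' := hder.fderiv
    simp only [Pi.add_def] at hder'
    rw [hder', hfield]
    simp only [add_apply, ContinuousLinearMap.comp_apply, ContinuousLinearMap.flip_apply]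
    simp only [← hz, ← hG]
    abel
  have hbr : toCoord 𝓘(ℝ, E) p p (D Z p (VectorField.mlieBracket 𝓘(ℝ, E) X Y p)) =
      fderiv ℝ (coordField p Z) z (fderiv ℝ (coordField p Y) z (coordField p X z)
        - fderiv ℝ (coordField p X) z (coordField p Y z))
      + G z (coordField p Z z) (fderiv ℝ (coordField p Y) z (coordField p X z)
        - fderiv ℝ (coordField p X) z (coordField p Y z)) := by
    rw [toCoord_covDeriv hp hZ.mdifferentiableAt, toCoord_mlieBracket hp hX.mdifferentiableAt
      hY.mdifferentiableAt, VectorField.lieBracket, hfield]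
  have key : toCoord 𝓘(ℝ, E) p p (curvature D X Y Z p) =
      localCurvature G z (coordField p X z) (coordField p Y z) (coordField p Z z) := by
    rw [curvature, map_sub, map_sub, second X Y hX hY, second Y X hY hX, hbr,
      hsymm.eq (coordField p X z)]
    simp only [localCurvature, map_add, map_sub, add_apply]
    abel
  rwa [toCoord_self, ← hfield, ← hfield, ← hfield, toCoord_self, toCoord_self, toCoord_self] at key

theorem isFlat_iff [T2Space M] (hD : CovariantDerivative.ContMDiffCovariantDerivative D ∞) :
    IsFlat D ↔ ∀ (p : M) (a b c : E),
      localCurvature (coordChristoffel D p) (extChartAt 𝓘(ℝ, E) p p) a b c = 0 := by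
  constructor
  · intro h p a b c
    have hp := mem_extChartAt_source (I := 𝓘(ℝ, E)) p
    have hs := fun a ↦ smoothVecAt_coordConst (I := 𝓘(ℝ, E)) hp a
    have := h p _ _ _ (hs a) (hs b) (hs c)
    rw [curvature_eq hD p (hs a) (hs b) (hs c)] at this
    simp only [coordConst, ofCoord_self] at this
    exact this
  · intro h p X Y Z hX hY hZ
    rw [curvature_eq hD p hX hY hZ]
    exact h p _ _ _

/-! ### The metric in a chart of the base -/

/-- The components of the bilinear form `g` in the preferred chart at `p₀`. -/
def coordMetric (p₀ : M)
    (g : ∀ x : M, TangentSpace 𝓘(ℝ, E) x →L[ℝ] TangentSpace 𝓘(ℝ, E) x →L[ℝ] ℝ) (z : E) :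
    E →L[ℝ] E →L[ℝ] ℝ :=
  let B : E →L[ℝ] E →L[ℝ] ℝ := g ((extChartAt 𝓘(ℝ, E) p₀).symm z)
  let S : E →L[ℝ] E := ofCoord 𝓘(ℝ, E) p₀ ((extChartAt 𝓘(ℝ, E) p₀).symm z)
  B.bilinearComp S S

variable {g : ∀ x : M, TangentSpace 𝓘(ℝ, E) x →L[ℝ] TangentSpace 𝓘(ℝ, E) x →L[ℝ] ℝ}

omit [FiniteDimensional ℝ E] in
theorem coordMetric_apply (z a b : E) : coordMetric p₀ g z a b =
    g ((extChartAt 𝓘(ℝ, E) p₀).symm z) (ofCoord 𝓘(ℝ, E) p₀ _ a) (ofCoord 𝓘(ℝ, E) p₀ _ b) := rfl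

omit [FiniteDimensional ℝ E] in
theorem coordMetric_extChartAt (hp : p ∈ (extChartAt 𝓘(ℝ, E) p₀).source) (a b : E) :
    coordMetric p₀ g (extChartAt 𝓘(ℝ, E) p₀ p) a b =
      g p (ofCoord 𝓘(ℝ, E) p₀ p a) (ofCoord 𝓘(ℝ, E) p₀ p b) := by
  rw [coordMetric_apply, (extChartAt 𝓘(ℝ, E) p₀).left_inv hp]

omit [FiniteDimensional ℝ E] in
theorem contMDiffAt_metric (hg : IsPseudoRiemannian g) {X Y : VecField 𝓘(ℝ, E) M}
    (hX : SmoothVecAt X p) (hY : SmoothVecAt Y p) :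
    ContMDiffAt 𝓘(ℝ, E) 𝓘(ℝ) ∞ (fun x ↦ g x (X x) (Y x)) p := by
  have := ContMDiffAt.clm_bundle_apply₂ (F₁ := E) (F₂ := E) (F₃ := ℝ) (n := ∞)
    (E₁ := (TangentSpace 𝓘(ℝ, E) : M → Type _)) (E₂ := (TangentSpace 𝓘(ℝ, E) : M → Type _))
    (E₃ := Bundle.Trivial M ℝ) (b := id) (hg.smooth p) hX hY
  rw [contMDiffAt_totalSpace] at this
  exact this.2

theorem contDiffAt_coordMetric (hg : IsPseudoRiemannian g) (p₀ : M) :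
    ContDiffAt ℝ ∞ (coordMetric p₀ g) (extChartAt 𝓘(ℝ, E) p₀ p₀) := by
  refine contDiffAt_clm_of_apply fun a ↦ contDiffAt_clm_of_apply fun b ↦ ?_
  have hp := mem_extChartAt_source (I := 𝓘(ℝ, E)) p₀
  have := contMDiffAt_metric hg (smoothVecAt_coordConst hp a) (smoothVecAt_coordConst hp b)
  exact (contMDiffAt_comp_extChartAt_symm_iff (n := ⊤) hp).1 this

omit [FiniteDimensional ℝ E] in
theorem coordMetric_symm (hg : IsPseudoRiemannian g) (z a b : E) :
    coordMetric p₀ g z a b = coordMetric p₀ g z b a := by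
  rw [coordMetric_apply, coordMetric_apply, hg.symm]

omit [FiniteDimensional ℝ E] in
theorem coordMetric_nondegenerate (hg : IsPseudoRiemannian g) {z : E}
    (hz : z ∈ (extChartAt 𝓘(ℝ, E) p₀).target) (a : E) (h : ∀ b, coordMetric p₀ g z a b = 0) :
    a = 0 := by
  have hs := (extChartAt 𝓘(ℝ, E) p₀).map_target hz
  have := hg.nondegenerate _ (ofCoord 𝓘(ℝ, E) p₀ _ a) fun w ↦ by
    rw [← ofCoord_toCoord hs w]
    exact h _
  rw [← toCoord_ofCoord hs a, this, map_zero]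

omit [FiniteDimensional ℝ E] in
theorem coordMetric_anti {J : EndField 𝓘(ℝ, E) M} (hg : IsSkewHermitian J g) {z : E}
    (hz : z ∈ (extChartAt 𝓘(ℝ, E) p₀).target) (a b : E) :
    coordMetric p₀ g z (coordEnd p₀ J z a) (coordEnd p₀ J z b) = -coordMetric p₀ g z a b := by
  have hs := (extChartAt 𝓘(ℝ, E) p₀).map_target hz
  simp only [coordMetric_apply, coordEnd, ContinuousLinearMap.comp_apply]
  rw [ofCoord_toCoord hs, ofCoord_toCoord hs, hg.anti]

/-- Metric compatibility in a chart. -/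
theorem fderiv_coordMetric (hg : IsPseudoRiemannian g) (hD : IsLeviCivita D g) (p₀ : M) :
    ∀ᶠ z in 𝓝 (extChartAt 𝓘(ℝ, E) p₀ p₀), ∀ a c d,
      fderiv ℝ (fun x ↦ coordMetric p₀ g x c d) z a =
        coordMetric p₀ g z (coordChristoffel D p₀ z c a) d
          + coordMetric p₀ g z c (coordChristoffel D p₀ z d a) := by
  refine eventually_of_forall_mem_source p₀ fun p hp a c d ↦ ?_
  have hc := smoothVecAt_coordConst hp c
  have hd := smoothVecAt_coordConst hp d
  have h := hD.metric p _ _ (ofCoord 𝓘(ℝ, E) p₀ p a) hc hd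
  rw [mvfderiv_eq_fderiv hp ((contMDiffAt_metric hg hc hd).mdifferentiableAt (by simp)),
    toCoord_ofCoord hp] at h
  refine Eq.trans ?_ (h.trans ?_)
  · rfl
  · rw [coordMetric_extChartAt hp, coordMetric_extChartAt hp, coordChristoffel_eq hp,
      coordChristoffel_eq hp, ofCoord_toCoord hp, ofCoord_toCoord hp]
    rfl

end Base

/-! ### The tangent bundle in an induced chart -/

section ChartChange

variable {F : Type*} [NormedAddCommGroup F] [NormedSpace ℝ F]
  {K : Type*} [TopologicalSpace K] {I : ModelWithCorners ℝ F K} [I.Boundaryless]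
  {N : Type*} [TopologicalSpace N] [ChartedSpace K N] [IsManifold I ∞ N]

/-- Since tangent vectors at `p` are their components in the preferred chart at `p`, the
components in another chart are given by the differential of the change of charts. -/
theorem hasFDerivAt_chartChange {p₀ p : N} (hp : p ∈ (extChartAt I p₀).source) :
    HasFDerivAt (extChartAt I p₀ ∘ (extChartAt I p).symm) (toCoord I p₀ p) (extChartAt I p p) := by
  have h := (mdifferentiableAt_extChartAt (I := I) (x := p₀) (y := p)
    (by simpa using hp)).hasMFDerivAt
  rw [← toCoord_eq_mfderiv hp] at h
  let A : F →L[ℝ] F := toCoord I p₀ p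
  have h2 : HasFDerivWithinAt (extChartAt I p₀ ∘ (extChartAt I p).symm) A (range I)
      (extChartAt I p p) := h.2
  rw [I.range_eq_univ, hasFDerivWithinAt_univ] at h2
  exact h2

end ChartChange

section TangentBundle

variable {E : Type*} [NormedAddCommGroup E] [NormedSpace ℝ E]
  {M : Type*} [TopologicalSpace M] [ChartedSpace E M] [IsManifold 𝓘(ℝ, E) ∞ M]
  {u₀ u : TangentBundle 𝓘(ℝ, E) M}

theorem mem_tangent_source_iff :
    u ∈ (extChartAt 𝓘(ℝ, E).tangent u₀).source ↔ u.1 ∈ (extChartAt 𝓘(ℝ, E) u₀.1).source := by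
  rw [extChartAt_source, extChartAt_source, TangentBundle.mem_chart_source_iff]

theorem extChartAt_tangent_apply (hu : u.1 ∈ (extChartAt 𝓘(ℝ, E) u₀.1).source) :
    extChartAt 𝓘(ℝ, E).tangent u₀ u =
      (extChartAt 𝓘(ℝ, E) u₀.1 u.1, toCoord 𝓘(ℝ, E) u₀.1 u.1 u.2) := by
  have hb : u.1 ∈ (trivializationAt E (TangentSpace 𝓘(ℝ, E)) u₀.1).baseSet := by simpa using hu
  have := FiberBundle.extChartAt (IB := 𝓘(ℝ, E)) (F := E)
    (E := (TangentSpace 𝓘(ℝ, E) : M → Type _)) u₀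
  rw [ModelWithCorners.tangent, this, toCoord, Trivialization.continuousLinearMapAt_apply,
    Trivialization.coe_linearMapAt_of_mem _ hb]
  rfl

theorem extChartAt_tangent_self :
    extChartAt 𝓘(ℝ, E).tangent u u = (extChartAt 𝓘(ℝ, E) u.1 u.1, u.2) := by
  rw [extChartAt_tangent_apply (mem_extChartAt_source u.1), toCoord_self]
  rfl

theorem extChartAt_tangent_symm {z : E} (hz : z ∈ (extChartAt 𝓘(ℝ, E) u.1).target) (y : E) :
    (extChartAt 𝓘(ℝ, E).tangent u).symm (z, y) =
      ⟨(extChartAt 𝓘(ℝ, E) u.1).symm z, coordConst 𝓘(ℝ, E) u.1 y _⟩ := by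
  have hx := (extChartAt 𝓘(ℝ, E) u.1).map_target hz
  set x := (extChartAt 𝓘(ℝ, E) u.1).symm z with hxdef
  let w : TangentBundle 𝓘(ℝ, E) M := ⟨x, coordConst 𝓘(ℝ, E) u.1 y x⟩
  have hw : extChartAt 𝓘(ℝ, E).tangent u w = (z, y) := by
    rw [extChartAt_tangent_apply (u := w) hx, (extChartAt 𝓘(ℝ, E) u.1).right_inv hz]
    exact congrArg (Prod.mk z) (toCoord_ofCoord hx y)
  rw [← hw, (extChartAt 𝓘(ℝ, E).tangent u).left_inv (mem_tangent_source_iff.2 hx)]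

/-- The induced charts of the tangent bundle are related by the change of charts of the base and
its differential. -/
theorem chartChange_tangent (hu : u.1 ∈ (extChartAt 𝓘(ℝ, E) u₀.1).source) :
    ∀ᶠ z in 𝓝 (extChartAt 𝓘(ℝ, E) u.1 u.1), ∀ y : E,
      (extChartAt 𝓘(ℝ, E).tangent u₀ ∘ (extChartAt 𝓘(ℝ, E).tangent u).symm) (z, y) =
        ((extChartAt 𝓘(ℝ, E) u₀.1 ∘ (extChartAt 𝓘(ℝ, E) u.1).symm) z,
          coordField u₀.1 (coordConst 𝓘(ℝ, E) u.1 y)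
            ((extChartAt 𝓘(ℝ, E) u₀.1 ∘ (extChartAt 𝓘(ℝ, E) u.1).symm) z)) := by
  have hp := mem_extChartAt_source (I := 𝓘(ℝ, E)) u.1
  filter_upwards [extChartAt_target_mem_nhds (I := 𝓘(ℝ, E)) u.1,
    eventually_extChartAt_symm hp (extChartAt_source_mem_nhds' hu)] with z hz hz' y
  rw [Function.comp_apply, Function.comp_apply, extChartAt_tangent_symm hz,
    extChartAt_tangent_apply (u := ⟨_, coordConst 𝓘(ℝ, E) u.1 y _⟩) hz']
  exact congrArg (Prod.mk _) (coordField_extChartAt hz' (coordConst 𝓘(ℝ, E) u.1 y)).symm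

/-- The vertical lift has components `(0, w)` in every induced chart. -/
theorem toCoord_verticalLift (hu : u.1 ∈ (extChartAt 𝓘(ℝ, E) u₀.1).source)
    (w : TangentSpace 𝓘(ℝ, E) u.1) :
    toCoord 𝓘(ℝ, E).tangent u₀ u (verticalLift u w) = (0, toCoord 𝓘(ℝ, E) u₀.1 u.1 w) := by
  have h := hasFDerivAt_chartChange (mem_tangent_source_iff.2 hu)
  rw [extChartAt_tangent_self] at h
  let y₀ : E := u.2
  let A : E × E →L[ℝ] E × E := toCoord 𝓘(ℝ, E).tangent u₀ u
  change HasFDerivAt _ A (extChartAt 𝓘(ℝ, E) u.1 u.1, y₀) at h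
  have h1 := h.comp y₀
    ((hasFDerivAt_const (extChartAt 𝓘(ℝ, E) u.1 u.1) y₀).prodMk (hasFDerivAt_id y₀))
  have hp := mem_extChartAt_source (I := 𝓘(ℝ, E)) u.1
  have hl := (extChartAt 𝓘(ℝ, E) u.1).left_inv hp
  let T : E →L[ℝ] E := toCoord 𝓘(ℝ, E) u₀.1 u.1
  have h2 : HasFDerivAt (fun y : E ↦ (extChartAt 𝓘(ℝ, E) u₀.1 u.1, T y)) _ y₀ :=
    (hasFDerivAt_const (extChartAt 𝓘(ℝ, E) u₀.1 u.1) y₀).prodMk T.hasFDerivAt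
  have he := h1.unique (h2.congr_of_eventuallyEq (Filter.Eventually.of_forall fun y ↦ by
    have := (chartChange_tangent hu).self_of_nhds y
    refine this.trans ?_
    rw [Function.comp_apply, hl, coordField_extChartAt hu, coordConst, ofCoord_self]
    rfl))
  exact DFunLike.congr_fun he w

variable [FiniteDimensional ℝ E] {D : AffineConnection E M}

omit [FiniteDimensional ℝ E] in
/-- `FiberBundle.extend` is a coordinate field near the base point only, which is enough by
locality of the connection. -/
theorem christoffel_eq (u : TangentBundle 𝓘(ℝ, E) M) (v : TangentSpace 𝓘(ℝ, E) u.1) :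
    christoffel D u v = D (coordConst 𝓘(ℝ, E) u.1 u.2) u.1 v := by
  have h : (trivializationAt E (TangentSpace 𝓘(ℝ, E)) u.1 ⟨u.1, u.2⟩).2 = u.2 := by
    have h' := toCoord_self u.1 u.2
    rwa [toCoord, Trivialization.continuousLinearMapAt_apply,
      Trivialization.coe_linearMapAt_of_mem _ (by simp)] at h'
  have hc := mdifferentiableAt_coordConst (mem_extChartAt_source (I := 𝓘(ℝ, E)) u.1) u.2
  have hev : ∀ᶠ x in 𝓝 u.1,
      coordConst 𝓘(ℝ, E) u.1 u.2 x = (FiberBundle.extend E u.2 : VecField 𝓘(ℝ, E) M) x := by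
    filter_upwards [(trivializationAt E (TangentSpace 𝓘(ℝ, E)) u.1).open_baseSet.mem_nhds
      (mem_baseSet_trivializationAt E (TangentSpace 𝓘(ℝ, E)) u.1)] with x hx
    rw [FiberBundle.extend, h]
    exact Trivialization.symmL_apply _ hx _
  rw [christoffel, D.isCovariantDerivativeOnUniv.congr_of_eventuallyEq hc
    (hc.congr_of_eventuallyEq (hev.mono fun x hx ↦ congrArg (TotalSpace.mk x) hx.symm))
    univ_mem hev]
  rfl

/-- The horizontal lift has components `(a, -yⁱ Γᵏᵢⱼ aʲ)` in every induced chart, although its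
definition refers to the chart centred at the base point. With `Y` the field that has constant
components in that chart, the transformation law of the Christoffel symbols is the formula for
`∇Y` in the other chart. -/
theorem toCoord_horizontalLift (hu : u.1 ∈ (extChartAt 𝓘(ℝ, E) u₀.1).source)
    (v : TangentSpace 𝓘(ℝ, E) u.1) :
    toCoord 𝓘(ℝ, E).tangent u₀ u (horizontalLift D u v) =
      localH (coordChristoffel D u₀.1) (extChartAt 𝓘(ℝ, E).tangent u₀ u)
        (toCoord 𝓘(ℝ, E) u₀.1 u.1 v) := by
  have hp := mem_extChartAt_source (I := 𝓘(ℝ, E)) u.1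
  have hl := (extChartAt 𝓘(ℝ, E) u.1).left_inv hp
  have h := hasFDerivAt_chartChange (mem_tangent_source_iff.2 hu)
  rw [extChartAt_tangent_self] at h
  obtain ⟨y₀, hy₀⟩ : ∃ y₀ : E, y₀ = u.2 := ⟨_, rfl⟩
  rw [← hy₀] at h
  let A : E × E →L[ℝ] E × E := toCoord 𝓘(ℝ, E).tangent u₀ u
  change HasFDerivAt _ A (extChartAt 𝓘(ℝ, E) u.1 u.1, y₀) at h
  have h1 := h.comp (extChartAt 𝓘(ℝ, E) u.1 u.1)
    ((hasFDerivAt_id (𝕜 := ℝ) (extChartAt 𝓘(ℝ, E) u.1 u.1)).prodMk (hasFDerivAt_const y₀ _))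
  let B : E →L[ℝ] E := toCoord 𝓘(ℝ, E) u₀.1 u.1
  have hψ : HasFDerivAt _ B _ := hasFDerivAt_chartChange hu
  have hY : HasFDerivAt (coordField u₀.1 (coordConst 𝓘(ℝ, E) u.1 y₀))
      (fderiv ℝ (coordField u₀.1 (coordConst 𝓘(ℝ, E) u.1 y₀)) (extChartAt 𝓘(ℝ, E) u₀.1 u.1))
      ((extChartAt 𝓘(ℝ, E) u₀.1 ∘ (extChartAt 𝓘(ℝ, E) u.1).symm) (extChartAt 𝓘(ℝ, E) u.1 u.1)) := by
    rw [Function.comp_apply, hl]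
    exact ((mdifferentiableAt_vecField_iff hu _).1 (mdifferentiableAt_coordConst hp y₀)).hasFDerivAt
  have h2 := HasFDerivAt.prodMk (𝕜 := ℝ) hψ
    (HasFDerivAt.comp (𝕜 := ℝ) (extChartAt 𝓘(ℝ, E) u.1 u.1) hY hψ)
  have he := h1.unique (h2.congr_of_eventuallyEq
    ((chartChange_tangent hu).mono fun z hz ↦ hz y₀))
  let e : E := v
  let c : E →L[ℝ] E := christoffel D u
  let w : TTangent u := (e, (0 : E))
  -- `e^H = (e, 0) - (∇_e Y)^V`, where `Y` has constant components `y₀` in the chart at `u.1`.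
  have hsplit : horizontalLift D u v = w - verticalLift u (c v) :=
    Prod.ext (sub_zero e).symm (zero_sub (c e)).symm
  have hbase : toCoord 𝓘(ℝ, E).tangent u₀ u w = (B e,
      fderiv ℝ (coordField u₀.1 (coordConst 𝓘(ℝ, E) u.1 y₀)) (extChartAt 𝓘(ℝ, E) u₀.1 u.1)
        (B e)) := DFunLike.congr_fun he e
  have hD : B (c v) = fderiv ℝ (coordField u₀.1 (coordConst 𝓘(ℝ, E) u.1 y₀))
      (extChartAt 𝓘(ℝ, E) u₀.1 u.1) (B e)
        + coordChristoffel D u₀.1 (extChartAt 𝓘(ℝ, E) u₀.1 u.1) (B y₀) (B e) := by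
    have hself : coordConst 𝓘(ℝ, E) u.1 y₀ u.1 = y₀ := ofCoord_self u.1 y₀
    have := toCoord_covDeriv (D := D) hu (mdifferentiableAt_coordConst hp y₀) v
    rw [hself] at this
    refine Eq.trans (congrArg B ?_) this
    rw [hy₀]
    exact christoffel_eq u v
  have hv : toCoord 𝓘(ℝ, E).tangent u₀ u (verticalLift u (c v)) = (0, B (c v)) :=
    toCoord_verticalLift hu _
  rw [hsplit, map_sub, hbase, hv, hD, extChartAt_tangent_apply hu, ← hy₀]
  change _ = (B e, -coordChristoffel D u₀.1 (extChartAt 𝓘(ℝ, E) u₀.1 u.1) (B y₀) (B e))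
  rw [Prod.mk_sub_mk, sub_zero, sub_add_cancel_left]

end TangentBundle

/-! ### The lifted structures in an induced chart -/

theorem localNijenhuis_congr {F : Type*} [NormedAddCommGroup F] [NormedSpace ℝ F]
    {A B : F → F →L[ℝ] F} {q : F} (h : A =ᶠ[𝓝 q] B) (x y : F) :
    localNijenhuis A q x y = localNijenhuis B q x y := by
  simp only [localNijenhuis, h.fderiv_eq, h.self_of_nhds]

section Lifts

variable {E : Type*} [NormedAddCommGroup E] [NormedSpace ℝ E] [FiniteDimensional ℝ E]
  {M : Type*} [TopologicalSpace M] [ChartedSpace E M] [IsManifold 𝓘(ℝ, E) ∞ M]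
  {D : AffineConnection E M} {J : EndField 𝓘(ℝ, E) M} {u₀ u : TangentBundle 𝓘(ℝ, E) M}

theorem exists_eq_horizontalLift_add_verticalLift
    (hu : u.1 ∈ (extChartAt 𝓘(ℝ, E) u₀.1).source) (ξ : E × E) :
    ∃ v w : TangentSpace 𝓘(ℝ, E) u.1,
      ofCoord 𝓘(ℝ, E).tangent u₀ u ξ = horizontalLift D u v + verticalLift u w ∧
      ξ = localH (coordChristoffel D u₀.1) (extChartAt 𝓘(ℝ, E).tangent u₀ u)
          (toCoord 𝓘(ℝ, E) u₀.1 u.1 v) + (0, toCoord 𝓘(ℝ, E) u₀.1 u.1 w) := by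
  have h := horizontalLift_add_verticalLift D u (ofCoord 𝓘(ℝ, E).tangent u₀ u ξ)
  refine ⟨_, _, h.symm, ?_⟩
  rw [← toCoord_horizontalLift hu, ← toCoord_verticalLift hu, ← map_add, h,
    toCoord_ofCoord (mem_tangent_source_iff.2 hu)]

theorem coordEnd_liftJ₁ (hu : u.1 ∈ (extChartAt 𝓘(ℝ, E) u₀.1).source) :
    coordEnd u₀ (liftJ₁ D) (extChartAt 𝓘(ℝ, E).tangent u₀ u) =
      localJ₁ (coordChristoffel D u₀.1) (extChartAt 𝓘(ℝ, E).tangent u₀ u) := by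
  refine ContinuousLinearMap.ext fun ξ ↦ ?_
  obtain ⟨v, w, h, h'⟩ := exists_eq_horizontalLift_add_verticalLift (D := D) hu ξ
  rw [coordEnd_extChartAt (mem_tangent_source_iff.2 hu), h, map_add, liftJ₁_horizontalLift,
    liftJ₁_verticalLift, map_add, map_neg, toCoord_horizontalLift hu, toCoord_verticalLift hu, h']
  rw [localJ₁_apply]
  ext <;> simp [localH]

theorem coordEnd_liftJ₂ (hu : u.1 ∈ (extChartAt 𝓘(ℝ, E) u₀.1).source) :
    coordEnd u₀ (liftJ₂ D J) (extChartAt 𝓘(ℝ, E).tangent u₀ u) =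
      localJ₂ (coordChristoffel D u₀.1) (coordEnd u₀.1 J)
        (extChartAt 𝓘(ℝ, E).tangent u₀ u) := by
  refine ContinuousLinearMap.ext fun ξ ↦ ?_
  obtain ⟨v, w, h, h'⟩ := exists_eq_horizontalLift_add_verticalLift (D := D) hu ξ
  have hJ : ∀ v : TangentSpace 𝓘(ℝ, E) u.1, toCoord 𝓘(ℝ, E) u₀.1 u.1 (J u.1 v) =
      coordEnd u₀.1 J (extChartAt 𝓘(ℝ, E).tangent u₀ u).1 (toCoord 𝓘(ℝ, E) u₀.1 u.1 v) := by
    intro v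
    rw [extChartAt_tangent_apply hu, coordEnd_extChartAt hu, ofCoord_toCoord hu]
  rw [coordEnd_extChartAt (mem_tangent_source_iff.2 hu), h, map_add, liftJ₂_horizontalLift,
    liftJ₂_verticalLift, map_add, toCoord_horizontalLift hu, toCoord_verticalLift hu, h', hJ, hJ]
  rw [localJ₂_apply]
  ext <;> simp [localH]; abel

theorem coordEnd_liftJ₃ (hu : u.1 ∈ (extChartAt 𝓘(ℝ, E) u₀.1).source) :
    coordEnd u₀ (liftJ₃ D J) (extChartAt 𝓘(ℝ, E).tangent u₀ u) =
      localJ₃ (coordChristoffel D u₀.1) (coordEnd u₀.1 J)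
        (extChartAt 𝓘(ℝ, E).tangent u₀ u) := by
  refine ContinuousLinearMap.ext fun ξ ↦ ?_
  have hu' := mem_tangent_source_iff.2 hu
  rw [localJ₃, ContinuousLinearMap.comp_apply, ← coordEnd_liftJ₁ hu, ← coordEnd_liftJ₂ hu,
    coordEnd_extChartAt hu', coordEnd_extChartAt hu', coordEnd_extChartAt hu',
    ofCoord_toCoord hu']
  rfl

omit [FiniteDimensional ℝ E] in
theorem eventuallyEq_of_forall_extChartAt {V : Type*} {f g : E × E → V}
    (u₀ : TangentBundle 𝓘(ℝ, E) M)
    (h : ∀ u : TangentBundle 𝓘(ℝ, E) M, u.1 ∈ (extChartAt 𝓘(ℝ, E) u₀.1).source →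
      f (extChartAt 𝓘(ℝ, E).tangent u₀ u) = g (extChartAt 𝓘(ℝ, E).tangent u₀ u)) :
    f =ᶠ[𝓝 (extChartAt 𝓘(ℝ, E).tangent u₀ u₀)] g := by
  filter_upwards [extChartAt_target_mem_nhds (I := 𝓘(ℝ, E).tangent) u₀] with r hr
  have := h _ (mem_tangent_source_iff.1 ((extChartAt 𝓘(ℝ, E).tangent u₀).map_target hr))
  rwa [(extChartAt 𝓘(ℝ, E).tangent u₀).right_inv hr] at this

theorem isAlmostComplex_liftJ₁ [T2Space M]
    (hD : CovariantDerivative.ContMDiffCovariantDerivative D ∞) :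
    IsAlmostComplex (liftJ₁ D) where
  smooth u := by
    rw [contMDiffAt_endField_iff]
    refine ContDiffAt.congr_of_eventuallyEq ?_
      (eventuallyEq_of_forall_extChartAt u fun w hw ↦ coordEnd_liftJ₁ hw)
    refine contDiffAt_localJ₁ ?_
    rw [extChartAt_tangent_self]
    exact contDiffAt_coordChristoffel hD u.1
  sq u ξ := by
    rw [← horizontalLift_add_verticalLift D u ξ]
    simp only [map_add, map_neg, liftJ₁_horizontalLift, liftJ₁_verticalLift]
    abel

theorem isAlmostComplex_liftJ₂ [T2Space M]
    (hD : CovariantDerivative.ContMDiffCovariantDerivative D ∞)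
    (hJ : IsAlmostComplex J) : IsAlmostComplex (liftJ₂ D J) where
  smooth u := by
    rw [contMDiffAt_endField_iff]
    refine ContDiffAt.congr_of_eventuallyEq ?_
      (eventuallyEq_of_forall_extChartAt u fun w hw ↦ coordEnd_liftJ₂ hw)
    refine contDiffAt_localJ₂ ?_ ?_ <;> rw [extChartAt_tangent_self]
    · exact contDiffAt_coordChristoffel hD u.1
    · exact (contMDiffAt_endField_iff u.1 J).1 (hJ.smooth u.1)
  sq u ξ := by
    rw [← horizontalLift_add_verticalLift D u ξ]
    simp only [map_add, map_neg, liftJ₂_horizontalLift, liftJ₂_verticalLift, hJ.sq]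
    abel

omit [FiniteDimensional ℝ E] in
theorem liftJ₁_liftJ₂ (u : TangentBundle 𝓘(ℝ, E) M) (ξ : TTangent u) :
    liftJ₁ D u (liftJ₂ D J u ξ) = -liftJ₂ D J u (liftJ₁ D u ξ) := by
  rw [← horizontalLift_add_verticalLift D u ξ]
  simp only [map_add, map_neg, liftJ₁_horizontalLift, liftJ₁_verticalLift, liftJ₂_horizontalLift,
    liftJ₂_verticalLift]
  abel

theorem isAlmostComplex_liftJ₃ [T2Space M]
    (hD : CovariantDerivative.ContMDiffCovariantDerivative D ∞)
    (hJ : IsAlmostComplex J) : IsAlmostComplex (liftJ₃ D J) where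
  smooth u := by
    rw [contMDiffAt_endField_iff]
    refine ContDiffAt.congr_of_eventuallyEq ?_
      (eventuallyEq_of_forall_extChartAt u fun w hw ↦ coordEnd_liftJ₃ hw)
    refine contDiffAt_localJ₃ ?_ ?_ <;> rw [extChartAt_tangent_self]
    · exact contDiffAt_coordChristoffel hD u.1
    · exact (contMDiffAt_endField_iff u.1 J).1 (hJ.smooth u.1)
  sq u ξ := by
    simp only [liftJ₃, ContinuousLinearMap.comp_apply]
    rw [neg_eq_iff_eq_neg.1 (liftJ₁_liftJ₂ u (liftJ₂ D J u ξ)).symm, map_neg,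
      (isAlmostComplex_liftJ₁ hD).sq, neg_neg, (isAlmostComplex_liftJ₂ hD hJ).sq]

/-- The algebraic part of the hypercomplex condition holds without assumptions on the curvature or
on `∇J`. -/
theorem isAlmostHypercomplex_lifts [T2Space M]
    (hD : CovariantDerivative.ContMDiffCovariantDerivative D ∞) (hJ : IsAlmostComplex J) :
    IsAlmostHypercomplex (liftJ₁ D) (liftJ₂ D J) (liftJ₃ D J) where
  first := isAlmostComplex_liftJ₁ hD
  second := isAlmostComplex_liftJ₂ hD hJ
  third := isAlmostComplex_liftJ₃ hD hJ
  anti₁₂ u := ContinuousLinearMap.ext fun ξ ↦ liftJ₁_liftJ₂ u ξ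
  anti₂₃ u := by
    refine ContinuousLinearMap.ext fun ξ ↦ ?_
    have := liftJ₁_liftJ₂ (D := D) (J := J) u (liftJ₂ D J u ξ)
    exact neg_eq_iff_eq_neg.1 this.symm
  anti₃₁ u := by
    refine ContinuousLinearMap.ext fun ξ ↦ ?_
    exact (congrArg (liftJ₁ D u) (neg_eq_iff_eq_neg.2 (liftJ₁_liftJ₂ u ξ)).symm).trans
      (map_neg _ _)
  comp_eq _ := rfl

/-! ### Integrability of the lifted structures -/

section Integrability

variable [T2Space M]

omit [FiniteDimensional ℝ E] [T2Space M] in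
/-- A point of `TM` over `p` is an arbitrary choice of fibre coordinates `y`. -/
theorem forall_tangentBundle_iff {P : M → E × E → Prop} :
    (∀ u : TangentBundle 𝓘(ℝ, E) M, P u.1 (extChartAt 𝓘(ℝ, E).tangent u u)) ↔
      ∀ (p : M) (y : E), P p (extChartAt 𝓘(ℝ, E) p p, y) := by
  constructor
  · intro h p y
    have := h ⟨p, y⟩
    rwa [extChartAt_tangent_self] at this
  · intro h u
    rw [extChartAt_tangent_self]
    exact h _ _

theorem isIntegrableComplex_liftJ₁_iff
    (hD : CovariantDerivative.ContMDiffCovariantDerivative D ∞) : IsIntegrableComplex (liftJ₁ D) ↔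
    ∀ (p : M) (y : E) (ξ η : E × E),
      localNijenhuis (localJ₁ (coordChristoffel D p)) (extChartAt 𝓘(ℝ, E) p p, y) ξ η = 0 := by
  have : CompleteSpace E := FiniteDimensional.complete ℝ E
  rw [isIntegrableComplex_iff (isAlmostComplex_liftJ₁ hD), ← forall_tangentBundle_iff
    (P := fun p q ↦ ∀ ξ η, localNijenhuis (localJ₁ (coordChristoffel D p)) q ξ η = 0)]
  refine forall_congr' fun u ↦ forall_congr' fun ξ ↦ forall_congr' fun η ↦ ?_
  rw [localNijenhuis_congr
    (eventuallyEq_of_forall_extChartAt u fun w hw ↦ coordEnd_liftJ₁ (D := D) hw)]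

theorem isIntegrableComplex_liftJ₂_iff
    (hD : CovariantDerivative.ContMDiffCovariantDerivative D ∞) (hJ : IsAlmostComplex J) :
    IsIntegrableComplex (liftJ₂ D J) ↔ ∀ (p : M) (y : E) (ξ η : E × E),
      localNijenhuis (localJ₂ (coordChristoffel D p) (coordEnd p J))
        (extChartAt 𝓘(ℝ, E) p p, y) ξ η = 0 := by
  have : CompleteSpace E := FiniteDimensional.complete ℝ E
  rw [isIntegrableComplex_iff (isAlmostComplex_liftJ₂ hD hJ), ← forall_tangentBundle_iff
    (P := fun p q ↦ ∀ ξ η,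
      localNijenhuis (localJ₂ (coordChristoffel D p) (coordEnd p J)) q ξ η = 0)]
  refine forall_congr' fun u ↦ forall_congr' fun ξ ↦ forall_congr' fun η ↦ ?_
  rw [localNijenhuis_congr
    (eventuallyEq_of_forall_extChartAt u fun w hw ↦ coordEnd_liftJ₂ (D := D) (J := J) hw)]

theorem isIntegrableComplex_liftJ₃_iff
    (hD : CovariantDerivative.ContMDiffCovariantDerivative D ∞) (hJ : IsAlmostComplex J) :
    IsIntegrableComplex (liftJ₃ D J) ↔ ∀ (p : M) (y : E) (ξ η : E × E),
      localNijenhuis (localJ₃ (coordChristoffel D p) (coordEnd p J))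
        (extChartAt 𝓘(ℝ, E) p p, y) ξ η = 0 := by
  have : CompleteSpace E := FiniteDimensional.complete ℝ E
  rw [isIntegrableComplex_iff (isAlmostComplex_liftJ₃ hD hJ), ← forall_tangentBundle_iff
    (P := fun p q ↦ ∀ ξ η,
      localNijenhuis (localJ₃ (coordChristoffel D p) (coordEnd p J)) q ξ η = 0)]
  refine forall_congr' fun u ↦ forall_congr' fun ξ ↦ forall_congr' fun η ↦ ?_
  rw [localNijenhuis_congr
    (eventuallyEq_of_forall_extChartAt u fun w hw ↦ coordEnd_liftJ₃ (D := D) (J := J) hw)]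

theorem isIntegrableComplex_liftJ₁_iff_isFlat
    (hD : CovariantDerivative.ContMDiffCovariantDerivative D ∞) (hT : IsTorsionFree D) :
    IsIntegrableComplex (liftJ₁ D) ↔ IsFlat D := by
  have hG : ∀ p : M, ContDiffAt ℝ 1 (coordChristoffel D p) (extChartAt 𝓘(ℝ, E) p p) := fun p ↦
    (contDiffAt_coordChristoffel hD p).of_le (by simp)
  rw [isIntegrableComplex_liftJ₁_iff hD, isFlat_iff hD]
  refine forall_congr' fun p ↦ ?_
  have hs := (coordChristoffel_symm hT p).self_of_nhds
  constructor
  · intro h a b c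
    exact (localNijenhuis_localJ₁_eq_zero_iff (q := (_, c)) (hG p) hs).1 (h c) a b
  · intro h y
    exact (localNijenhuis_localJ₁_eq_zero_iff (q := (_, y)) (hG p) hs).2 fun a b ↦ h a b y

omit [FiniteDimensional ℝ E] [T2Space M] in
theorem eventually_coordEnd_sq (hJ : IsAlmostComplex J) (p : M) :
    ∀ᶠ z in 𝓝 (extChartAt 𝓘(ℝ, E) p p), ∀ v, coordEnd p J z (coordEnd p J z v) = -v := by
  filter_upwards [extChartAt_target_mem_nhds (I := 𝓘(ℝ, E)) p] with z hz
  exact coordEnd_sq hJ.sq hz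

variable {g : ∀ x : M, TangentSpace 𝓘(ℝ, E) x →L[ℝ] TangentSpace 𝓘(ℝ, E) x →L[ℝ] ℝ}

omit [FiniteDimensional ℝ E] [T2Space M] in
theorem eventually_coordMetric_comm (hJ : IsAlmostComplex J) (hg : IsSkewHermitian J g) (p : M) :
    ∀ᶠ z in 𝓝 (extChartAt 𝓘(ℝ, E) p p), ∀ v w,
      coordMetric p g z (coordEnd p J z v) w = coordMetric p g z v (coordEnd p J z w) := by
  filter_upwards [extChartAt_target_mem_nhds (I := 𝓘(ℝ, E)) p] with z hz
  exact apply_comm_of_anti (coordEnd_sq hJ.sq hz) (coordMetric_anti hg hz)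

omit [T2Space M] in
theorem localNabla_coord_selfAdjoint (hJ : IsAlmostComplex J) (hg : IsSkewHermitian J g)
    (hLC : IsLeviCivita D g) (p : M) (a c d : E) :
    coordMetric p g (extChartAt 𝓘(ℝ, E) p p)
        (localNabla (coordChristoffel D p) (coordEnd p J) (extChartAt 𝓘(ℝ, E) p p) a c) d =
      coordMetric p g (extChartAt 𝓘(ℝ, E) p p) c
        (localNabla (coordChristoffel D p) (coordEnd p J) (extChartAt 𝓘(ℝ, E) p p) a d) :=
  localNabla_selfAdjoint
    (((contMDiffAt_endField_iff p J).1 (hJ.smooth p)).differentiableAt (by simp))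
    ((contDiffAt_coordMetric hg.toIsPseudoRiemannian p).differentiableAt (by simp))
    (fderiv_coordMetric hg.toIsPseudoRiemannian hLC p).self_of_nhds
    (eventually_coordMetric_comm hJ hg p) a c d

omit [T2Space M] in
theorem isParallel_of_localNabla_symm (hJ : IsAlmostComplex J) (hg : IsSkewHermitian J g)
    (hLC : IsLeviCivita D g)
    (h : ∀ (p : M) (c d : E),
      localNabla (coordChristoffel D p) (coordEnd p J) (extChartAt 𝓘(ℝ, E) p p)
          (coordEnd p J (extChartAt 𝓘(ℝ, E) p p) d) c =
        localNabla (coordChristoffel D p) (coordEnd p J) (extChartAt 𝓘(ℝ, E) p p)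
          (coordEnd p J (extChartAt 𝓘(ℝ, E) p p) c) d) : IsParallel D J := by
  refine isParallel_of_localNabla hJ fun p ↦ ?_
  have hsq := eventually_coordEnd_sq hJ p
  exact eq_zero_of_symm_of_anticomm (coordMetric_symm hg.toIsPseudoRiemannian _)
    (coordMetric_nondegenerate hg.toIsPseudoRiemannian (mem_extChartAt_target p)) hsq.self_of_nhds
    (eventually_coordMetric_comm hJ hg p).self_of_nhds
    (localNabla_apply_right
      (((contMDiffAt_endField_iff p J).1 (hJ.smooth p)).differentiableAt (by simp)) hsq)
    (localNabla_coord_selfAdjoint hJ hg hLC p) (h p)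

omit [T2Space M] in
theorem isParallel_of_localNabla_anticomm (hJ : IsAlmostComplex J) (hg : IsSkewHermitian J g)
    (hLC : IsLeviCivita D g)
    (h : ∀ (p : M) (a d : E),
      coordEnd p J (extChartAt 𝓘(ℝ, E) p p)
          (localNabla (coordChristoffel D p) (coordEnd p J) (extChartAt 𝓘(ℝ, E) p p) a d)
        + localNabla (coordChristoffel D p) (coordEnd p J) (extChartAt 𝓘(ℝ, E) p p)
          (coordEnd p J (extChartAt 𝓘(ℝ, E) p p) a) d = 0) : IsParallel D J := by
  refine isParallel_of_localNabla hJ fun p ↦ ?_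
  have hsq := eventually_coordEnd_sq hJ p
  exact eq_zero_of_anticomm (coordMetric_symm hg.toIsPseudoRiemannian _)
    (coordMetric_nondegenerate hg.toIsPseudoRiemannian (mem_extChartAt_target p)) hsq.self_of_nhds
    (eventually_coordMetric_comm hJ hg p).self_of_nhds
    (localNabla_apply_right
      (((contMDiffAt_endField_iff p J).1 (hJ.smooth p)).differentiableAt (by simp)) hsq)
    (localNabla_coord_selfAdjoint hJ hg hLC p) (h p)

/-- `J₂` yields flatness directly and parallelism by the algebra of Norden metrics. -/
theorem isIntegrableComplex_liftJ₂_iff_isFlat_and_isParallel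
    (hD : CovariantDerivative.ContMDiffCovariantDerivative D ∞) (hJ : IsAlmostComplex J)
    (hg : IsSkewHermitian J g) (hLC : IsLeviCivita D g) :
    IsIntegrableComplex (liftJ₂ D J) ↔ IsFlat D ∧ IsParallel D J := by
  have hG : ∀ p : M, ContDiffAt ℝ 1 (coordChristoffel D p) (extChartAt 𝓘(ℝ, E) p p) := fun p ↦
    (contDiffAt_coordChristoffel hD p).of_le (by simp)
  have hj : ∀ p : M, ContDiffAt ℝ 1 (coordEnd p J) (extChartAt 𝓘(ℝ, E) p p) := fun p ↦
    ((contMDiffAt_endField_iff p J).1 (hJ.smooth p)).of_le (by simp)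
  have key := fun (p : M) (y : E) ↦ localNijenhuis_localJ₂_eq_zero_iff
    (q := (extChartAt 𝓘(ℝ, E) p p, y)) (hG p) (hj p)
    (coordChristoffel_symm hLC.torsionFree p).self_of_nhds (eventually_coordEnd_sq hJ p)
  rw [isIntegrableComplex_liftJ₂_iff hD hJ, isFlat_iff hD]
  constructor
  · intro h
    refine ⟨fun p a b c ↦ ((key p c).1 (h p c)).1 a b, ?_⟩
    exact isParallel_of_localNabla_symm hJ hg hLC fun p c d ↦ ((key p 0).1 (h p 0)).2 c d
  · rintro ⟨hR, hP⟩ p y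
    have hT := (hP.localNabla_eq_zero hJ p).self_of_nhds
    exact (key p y).2 ⟨fun c d ↦ hR p c d y, fun c d ↦ by rw [hT, hT]⟩

/-- The mixed values of `N₃` yield parallelism first; flatness follows from the horizontal values,
since the curvature of a parallel structure commutes with it. -/
theorem isIntegrableComplex_liftJ₃_iff_isFlat_and_isParallel
    (hD : CovariantDerivative.ContMDiffCovariantDerivative D ∞) (hJ : IsAlmostComplex J)
    (hg : IsSkewHermitian J g) (hLC : IsLeviCivita D g) :
    IsIntegrableComplex (liftJ₃ D J) ↔ IsFlat D ∧ IsParallel D J := by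
  have hG : ∀ p : M, ContDiffAt ℝ 1 (coordChristoffel D p) (extChartAt 𝓘(ℝ, E) p p) := fun p ↦
    (contDiffAt_coordChristoffel hD p).of_le (by simp)
  have hj : ∀ p : M, ContDiffAt ℝ ∞ (coordEnd p J) (extChartAt 𝓘(ℝ, E) p p) := fun p ↦
    (contMDiffAt_endField_iff p J).1 (hJ.smooth p)
  have hj1 : ∀ p : M, ContDiffAt ℝ 1 (coordEnd p J) (extChartAt 𝓘(ℝ, E) p p) := fun p ↦
    (hj p).of_le (by simp)
  have h2 : (2 : WithTop ℕ∞) ≤ ∞ := by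
    simpa using (WithTop.coe_le_coe.2 le_top : ((2 : ℕ∞) : WithTop ℕ∞) ≤ ∞)
  have hsq := fun p : M ↦ (eventually_coordEnd_sq hJ p).self_of_nhds
  rw [isIntegrableComplex_liftJ₃_iff hD hJ, isFlat_iff hD]
  constructor
  · intro h
    have hP : IsParallel D J := isParallel_of_localNabla_anticomm hJ hg hLC fun p a d ↦ by
      have := h p 0 (localH (coordChristoffel D p) (extChartAt 𝓘(ℝ, E) p p, 0) a) (0, d)
      rw [localNijenhuis_localJ₃_mixed (q := (extChartAt 𝓘(ℝ, E) p p, 0)) (hG p) (hj1 p)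
        (hsq p)] at this
      exact congrArg Prod.snd this
    refine ⟨fun p ↦ ?_, hP⟩
    have hGd := (hG p).differentiableAt one_ne_zero
    have hT := hP.localNabla_eq_zero hJ p
    refine curvature_eq_zero (coordMetric_symm hg.toIsPseudoRiemannian _)
      (coordMetric_nondegenerate hg.toIsPseudoRiemannian (mem_extChartAt_target p)) (hsq p)
      (eventually_coordMetric_comm hJ hg p).self_of_nhds localCurvature_neg_right
      localCurvature_swap (localCurvature_bianchi hGd (coordChristoffel_symm hLC.torsionFree p))
      (localCurvature_skew hGd ((contDiffAt_coordMetric hg.toIsPseudoRiemannian p).of_le h2)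
        (fderiv_coordMetric hg.toIsPseudoRiemannian hLC p))
      (localCurvature_apply_comm hGd ((hj p).of_le h2) hT) fun a b c ↦ ?_
    have := h p c (localH (coordChristoffel D p) (extChartAt 𝓘(ℝ, E) p p, c) a)
      (localH (coordChristoffel D p) (extChartAt 𝓘(ℝ, E) p p, c) b)
    rw [localNijenhuis_localJ₃_horizontal (q := (extChartAt 𝓘(ℝ, E) p p, c)) (hG p) (hj1 p)
      (hsq p)] at this
    -- Once the horizontal lift of `N_j(a, b)` vanishes, the second component is the vertical part.
    have h1 : localNijenhuis (coordEnd p J) (extChartAt 𝓘(ℝ, E) p p) a b = 0 := by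
      have := congrArg Prod.fst this
      simpa [localH] using this
    rw [h1, map_zero, zero_add] at this
    exact congrArg Prod.snd this
  · rintro ⟨hR, hP⟩ p y ξ η
    exact localNijenhuis_localJ₃_eq_zero (q := (extChartAt 𝓘(ℝ, E) p p, y)) (hG p) (hj1 p)
      (coordChristoffel_symm hLC.torsionFree p).self_of_nhds (hsq p) (fun c d ↦ hR p c d y)
      (hP.localNabla_eq_zero hJ p).self_of_nhds ξ η

end Integrability

end Lifts

end

theorem mainTheorem1
    {E : Type*} [NormedAddCommGroup E] [NormedSpace ℝ E] [FiniteDimensional ℝ E]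
    {M : Type*} [TopologicalSpace M] [T2Space M] [ChartedSpace E M] [IsManifold 𝓘(ℝ, E) ∞ M]
    (J : EndField 𝓘(ℝ, E) M) (hJ : IsAlmostComplex J)
    (D : AffineConnection E M) (hD : CovariantDerivative.ContMDiffCovariantDerivative D ∞) :
    (IsTorsionFree D → (IsIntegrableComplex (liftJ₁ D) ↔ IsFlat D)) ∧
    (∀ g : ∀ x : M, TangentSpace 𝓘(ℝ, E) x →L[ℝ] TangentSpace 𝓘(ℝ, E) x →L[ℝ] ℝ,
      IsSkewHermitian J g → IsLeviCivita D g →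
        (IsIntegrableComplex (liftJ₂ D J) ↔ IsFlat D ∧ IsParallel D J) ∧
        (IsIntegrableComplex (liftJ₃ D J) ↔ IsFlat D ∧ IsParallel D J) ∧
        (IsHypercomplex (liftJ₁ D) (liftJ₂ D J) (liftJ₃ D J) ↔ IsFlat D ∧ IsParallel D J)) := by
  refine ⟨isIntegrableComplex_liftJ₁_iff_isFlat hD, fun g hg hLC ↦ ?_⟩
  have h₁ := isIntegrableComplex_liftJ₁_iff_isFlat hD hLC.torsionFree
  have h₂ := isIntegrableComplex_liftJ₂_iff_isFlat_and_isParallel hD hJ hg hLC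
  have h₃ := isIntegrableComplex_liftJ₃_iff_isFlat_and_isParallel hD hJ hg hLC
  refine ⟨h₂, h₃, fun h ↦ h₂.1 h.2.2.1, fun h ↦ ?_⟩
  exact ⟨isAlmostHypercomplex_lifts hD hJ, h₁.2 h.1, h₂.2 h, h₃.2 h⟩
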